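/- Let $d\in\{1,2,3\}$, let $\Omega\subset\mathbb R^d$ be bounded and open, and let $c,b>0$. Let $\mathcal A$ be a positive self-adjoint operator in $L^2(\Omega)$ that acts in the sense of distributions as a second order elliptic operator $u\mapsto-\sum_{i,j}\partial_i(a_{ij}\partial_j u)+qu$ (for instance $-\Delta$) with symmetric, uniformly elliptic $a_{ij}\in C^1(\Omega)$ and bounded measurable $q$, equipped with homogeneous linear boundary conditions, such that $\mathcal D(\mathcal A)\subseteq H^2(\Omega)$, where $H^2(\Omega)$ is the space of restrictions to $\Omega$ of elements of $H^2(\mathbb R^d)$. (Since $d\le 3$, every $u\in\mathcal D(\mathcal A)$ is then continuous on $\overline\Omega$.) Let $(\lambda_j,\phi_j)_{j\in\mathbb N}$ be an eigensystem of $\mathcal A$, with $(\phi_j)$ an orthonormal basis of $L^2(\Omega)$, and put $K_m=\{k:\lambda_k=\lambda_m\}$. Let $\Sigma\subseteq\overline\Omega$ and $T\in(0,\infty]$. Let $f\in\mathcal D(\mathcal A)$ vanish only on a set of measure zero, let $\beta$ be twice differentiable with $\beta''\in L^2_{loc}([0,\infty))$, put $\psi=(\beta^2)''$, and suppose $\psi(t_0)\neq0$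 for some $t_0\in(0,T)$. Consider the Westervelt equation $p_{tt}+c^2\mathcal A p+b\mathcal A p_t=\kappa(x)(p^2)_{tt}+r$ with excitation $$r(x,t)=f(x)\beta''(t)+\mathcal A f(x)\,\bigl(c^2\beta(t)+b\beta'(t)\bigr)$$ and initial values $p(0)=\beta(0)f$, $p_t(0)=\beta'(0)f$ (homogeneous if $\beta(0)=\beta'(0)=0$), so that for $\kappa=0$ the solution is $p_0(x,t)=f(x)\beta(t)$, and $(\underline{d\kappa}\,p_0^2)_{tt}=\sum_j a_j\phi_j(x)\psi(t)$ with $a_j=\langle\underline{d\kappa}\,f^2,\phi_j\rangle_{L^2(\Omega)}$. The linearisation at $\kappa=0$ of the forward operator $F:\kappa\mapsto p|_{\Sigma\times(0,T)}$ is the map $$F'(0):L^\infty(\Omega)\ni\underline{d\kappa}\mapsto z_0|_{\Sigma\times(0,T)},$$ where $z_0$ is the strong solution, in $H^2(0,\tau;L^2(\Omega))\cap H^1(0,\tau;\mathcal D(\mathcal A))$ for all $\tau<\infty$, of $$z_{0,tt}+c^2\mathcal A z_0+b\mathcal A z_{0,t}=\underline{d\kappa}\,(p_0^2)_{tt},\qquad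 z_0(0)=z_{0,t}(0)=0 .$$ Let $p_{m,\pm}=\tfrac12\bigl(-b\pm\sqrt{b^2-4c^2/\lambda_m}\bigr)\lambda_m$ be the poles of $s\mapsto(s^2+c^2\lambda_m+b\lambda_m s)^{-1}$, and assume for every $m\in\mathbb N$: 1. the Laplace transform $\widehat\psi$ converges absolutely in some right half plane and has a holomorphic continuation to a connected open set containing this half plane and $p_{m,+}$ that does not vanish at $p_{m,+}$ (or the same holds with $p_{m,-}$ in place of $p_{m,+}$); 2. $K_m$ is finite and there are $N_m\in\mathbb N$ and points $x_{0,m,1},\dots,x_{0,m,N_m}\in\Sigma$ such that the matrix $\bigl(\phi_k(x_{0,m,i})\bigr)_{k\in K_m,\ 1\le i\le N_m}$ has full rank $\#K_m$. Then $F'(0)$ is injective: if $\underline{d\kappa}_1,\underline{d\kappa}_2\in L^\infty(\Omega)$ and $F'(0)\underline{d\kappa}_1=F'(0)\underline{d\kappa}_2$ on $\Sigma\times(0,T)$, then $\underline{d\kappa}_1=\underline{d\kappa}_2$ almost everywhere in $\Omega$. -/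

import Mathlib

open MeasureTheory Set
open scoped ENNReal ContDiff SchwartzMap

noncomputable section

namespace Westervelt

/-- Euclidean space `ℝ^d`. -/
abbrev E (d : ℕ) : Type := EuclideanSpace ℝ (Fin d)

/-- The real Hilbert space `L²(Ω)`. -/
abbrev L2 {d : ℕ} (Ω : Set (E d)) : Type := Lp ℝ 2 (volume.restrict Ω)

/-- The space `L^∞(Ω)`. -/
abbrev LInf {d : ℕ} (Ω : Set (E d)) : Type := Lp ℝ ∞ (volume.restrict Ω)

/-- `u ∈ H²(Ω)`: `u` is the restriction to `Ω` of an element of the (Bessel potential) Sobolev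
space `H²(ℝ^d)`. -/
def MemH2 {d : ℕ} (Ω : Set (E d)) (u : L2 Ω) : Prop :=
  ∃ v : Lp ℂ 2 (volume : Measure (E d)),
    TemperedDistribution.MemSobolev 2 2 (v : 𝓢'(E d, ℂ)) ∧
      ∀ᵐ x ∂(volume.restrict Ω), v x = ((u x : ℝ) : ℂ)

/-- The value at `x` of the representative of `u` that is continuous on the closure of the open set
`Ω`. This representative is unique on the closure. -/
def pointValue {d : ℕ} (Ω : Set (E d)) (u : L2 Ω) (x : E d) : ℝ :=
  open Classical in
  if h : ∃ g : E d → ℝ, ContinuousOn g (closure Ω) ∧ u =ᵐ[volume.restrict Ω] g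
  then h.choose x else 0

/-- The differential expression `φ ↦ -∑ i j, ∂ᵢ (aᵢⱼ ∂ⱼ φ) + q φ`. -/
def divForm {d : ℕ} (a : Fin d → Fin d → E d → ℝ) (q : E d → ℝ) (φ : E d → ℝ) (x : E d) : ℝ :=
  -(∑ i, ∑ j, fderiv ℝ (fun y => a i j y * fderiv ℝ φ y (EuclideanSpace.single j 1)) x
      (EuclideanSpace.single i 1)) + q x * φ x

/-- `A` is a positive self-adjoint operator in `L²(Ω)`, with domain contained in `H²(Ω)`, which acts
(in the sense of distributions) as a second order elliptic operator
`-∑ i j, ∂ᵢ (aᵢⱼ ∂ⱼ u) + q u`; for `aᵢⱼ = δᵢⱼ`, `q = 0` this is `-Δ`. The homogeneous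
linear boundary conditions are those that the elements of the subspace `A.domain` satisfy.
By the closed graph theorem the inclusion of the domain in `H²(Ω)` is continuous. -/
structure IsEllipticRealisation {d : ℕ} (Ω : Set (E d)) (A : L2 Ω →ₗ.[ℝ] L2 Ω) : Prop where
  selfAdjoint : IsSelfAdjoint A
  pos : ∀ u : A.domain, u ≠ 0 → 0 < inner ℝ (A u) (u : L2 Ω)
  domain_H2 : ∀ u ∈ A.domain, MemH2 Ω u
  elliptic : ∃ (a : Fin d → Fin d → E d → ℝ) (q : E d → ℝ),
    (∀ i j, ContDiffOn ℝ 1 (a i j) Ω) ∧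
    (∀ i j, ∀ x ∈ Ω, a i j x = a j i x) ∧
    (∃ θ : ℝ, 0 < θ ∧ ∀ x ∈ Ω, ∀ ξ : Fin d → ℝ,
      θ * ∑ i, ξ i ^ 2 ≤ ∑ i, ∑ j, a i j x * ξ i * ξ j) ∧
    Measurable q ∧ (∃ M : ℝ, ∀ x ∈ Ω, |q x| ≤ M) ∧
    ∀ (u : A.domain) (φ : E d → ℝ), ContDiff ℝ ∞ φ → HasCompactSupport φ → tsupport φ ⊆ Ω →
      ∫ x in Ω, (A u) x * φ x = ∫ x in Ω, (u : L2 Ω) x * divForm a q φ x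

/-- `u`, with time derivatives `ut` and `utt`, is the strong solution on `(0, ∞)` of
`u_tt + c² A u + b A u_t = g`, `u(0) = u₀`, `u_t(0) = u₁`, of class
`H²(0,τ; L²(Ω)) ∩ H¹(0,τ; D(A))` for every `τ < ∞`. -/
structure IsStrongSolution {d : ℕ} {Ω : Set (E d)} (A : L2 Ω →ₗ.[ℝ] L2 Ω) (c b : ℝ)
    (g : ℝ → E d → ℝ) (u₀ u₁ : L2 Ω) (u ut utt : ℝ → L2 Ω) : Prop where
  utt_memLp : ∀ τ : ℝ, MemLp utt 2 (volume.restrict (Ioc 0 τ))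
  ut_eq : ∀ t : ℝ, 0 ≤ t → ut t = u₁ + ∫ s in (0 : ℝ)..t, utt s
  u_eq : ∀ t : ℝ, 0 ≤ t → u t = u₀ + ∫ s in (0 : ℝ)..t, ut s
  equation : ∃ Au Aut : ℝ → L2 Ω,
    (∀ t : ℝ, 0 ≤ t → (u t, Au t) ∈ A.graph) ∧
    (∀ᵐ t ∂(volume.restrict (Ioi (0 : ℝ))), (ut t, Aut t) ∈ A.graph) ∧
    (∀ τ : ℝ, MemLp Aut 2 (volume.restrict (Ioc 0 τ))) ∧
    ∀ᵐ t ∂(volume.restrict (Ioi (0 : ℝ))), ∀ᵐ x ∂(volume.restrict Ω),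
      utt t x + c ^ 2 * Au t x + b * Aut t x = g t x

/-- `z` is the derivative at `κ = 0` in direction `dκ` of the state `p` governed by the
Westervelt equation `p_tt + c² A p + b A p_t = κ (p²)_tt + r`, `p(0) = u₀`, `p_t(0) = u₁`:
with `p₀` the solution for `κ = 0`, it solves
`z_tt + c² A z + b A z_t = dκ (p₀²)_tt = 2 dκ (p₀ p₀_tt + p₀_t²)` with `z(0) = z_t(0) = 0`. -/
def IsLinearisedState {d : ℕ} {Ω : Set (E d)} (A : L2 Ω →ₗ.[ℝ] L2 Ω) (c b : ℝ)
    (r : ℝ → E d → ℝ) (u₀ u₁ : L2 Ω) (dκ : LInf Ω) (z : ℝ → L2 Ω) : Prop :=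
  ∃ p pt ptt zt ztt : ℝ → L2 Ω,
    IsStrongSolution A c b r u₀ u₁ p pt ptt ∧
    IsStrongSolution A c b (fun t x => 2 * dκ x * (p t x * ptt t x + pt t x ^ 2)) 0 0 z zt ztt

/-- The linearisation at `κ = 0` of the forward operator `κ ↦ p|_{S × (0,T)}`, i.e. the map
`dκ ↦ z|_{S × (0,T)}` with `z` the (unique) linearised state. -/
def linearisedForward {d : ℕ} {Ω : Set (E d)} (A : L2 Ω →ₗ.[ℝ] L2 Ω) (c b : ℝ)
    (r : ℝ → E d → ℝ) (u₀ u₁ : L2 Ω) (S : Set (E d)) (T : EReal) (dκ : LInf Ω) :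
    S → {t : ℝ // 0 < t ∧ (t : EReal) < T} → ℝ :=
  fun x t =>
    open Classical in
    if h : ∃ z : ℝ → L2 Ω, IsLinearisedState A c b r u₀ u₁ dκ z
    then pointValue Ω (h.choose t) x else 0

/-- The excitation `r(t,x) = f(x) β''(t) + (A f)(x) (c² β(t) + b β'(t))`. -/
def excitation {d : ℕ} {Ω : Set (E d)} (A : L2 Ω →ₗ.[ℝ] L2 Ω) (c b : ℝ) (f : A.domain)
    (β : ℝ → ℝ) (t : ℝ) (x : E d) : ℝ :=
  (f : L2 Ω) x * deriv (deriv β) t + (A f) x * (c ^ 2 * β t + b * deriv β t)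

/-- The time factor `ψ = (β²)''`. -/
def timeFactor (β : ℝ → ℝ) : ℝ → ℝ := deriv (deriv fun t => β t ^ 2)

/-- The pole `p₊ = (-b + √(b² - 4c²/μ)) μ / 2` of `1 / (s² + c² μ + b μ s)`. -/
def polePlus (b c μ : ℝ) : ℂ :=
  1 / 2 * (-b + ((b : ℂ) ^ 2 - 4 * (c : ℂ) ^ 2 / μ) ^ (1 / 2 : ℂ)) * μ

/-- The pole `p₋ = (-b - √(b² - 4c²/μ)) μ / 2` of `1 / (s² + c² μ + b μ s)`. -/
def poleMinus (b c μ : ℝ) : ℂ :=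
  1 / 2 * (-b - ((b : ℂ) ^ 2 - 4 * (c : ℂ) ^ 2 / μ) ^ (1 / 2 : ℂ)) * μ

/-- The Laplace transform of `ψ` converges absolutely in some half plane `Re s > σ`, and it has a
holomorphic continuation to a connected open set containing `p` that does not vanish at `p`. -/
def LaplaceNonvanishingAt (ψ : ℝ → ℝ) (p : ℂ) : Prop :=
  ∃ (σ : ℝ) (U : Set ℂ) (H : ℂ → ℂ),
    IsOpen U ∧ IsPreconnected U ∧ {s : ℂ | σ < s.re} ⊆ U ∧ p ∈ U ∧ DifferentiableOn ℂ H U ∧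
    (∀ s : ℂ, σ < s.re →
      IntegrableOn (fun t : ℝ => Complex.exp (-s * t) * (ψ t : ℂ)) (Ioi 0) ∧
      H s = ∫ t in Ioi (0 : ℝ), Complex.exp (-s * t) * (ψ t : ℂ)) ∧
    H p ≠ 0

end Westervelt

end

/-!
The linearised state is `z t = ∑ j, a j * z j t • φ j`, where `a j = ⟪φ j, dκ f²⟫` and `z j` solves
the damped oscillator `z'' + b λ z' + c² λ z = ψ` for the eigenvalue `λ` of `φ j`, with zero initial
values. Energy estimates that are uniform in the eigenvalue give convergence and existence
(`exists_modal_solution`); projection to the eigenbasis gives uniqueness (`IsStrongSolution.eqOn`).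

The graph of `A` embeds continuously in `C(closure Ω)`, by the Sobolev embedding and the closed
graph theorem. Evaluation at a point `x` is therefore bounded for the graph norm, the numbers
`φ j x / (1 + λ j)` are square summable (`summable_sq_pointValue`), and the observation at `x` is
`∑ j, k j * (1 + λ j) * z j t` with absolutely summable `k j = a j * φ j x / (1 + λ j)`.

Suppose that this series vanishes for `t` in `(0, τ)`, with `t₀ < τ < T`. Integration by parts over
`(0, τ)` shows that, with `P s = ∫ exp (s (τ - t)) ψ t` over `(0, τ)` and the transfer function
`g s = ∑ j, k j (1 + λ j) / (s² + b λ j s + c² λ j)`, the product `P * g` is a series of values at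
the final time `τ`. Both `g` and `P * g` are bounded on the part away from `0` of a sector larger
than a half plane. If `g` were nonzero at a large real point, then `P`, a quotient of two bounded
functions, would grow at most like `exp (K x ^ (2 / 3))` on the positive reals. This comes from
dividing out the zeros on a disc and applying the Borel-Carathéodory theorem to the logarithm; the
sector, opened by the map `ζ ^ (3 / 2)`, is responsible for the exponent `2 / 3 < 1`
(`norm_le_exp_of_bounded_quotient_sector`). The Phragmén-Lindelöf principle and Liouville's theorem
then give `P = 0`, hence `ψ = 0` almost everywhere on `(0, τ)`, against `ψ t₀ ≠ 0`. This argument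
takes the place of Titchmarsh's convolution theorem and uses the source on `(0, τ)` only.

So `g` vanishes at large reals. In the variable `ν = s² / (b s + c²)` it is, up to a factor, the
resolvent series `∑ j, k j (1 + λ j) / (λ j + ν)`, and its behaviour at `ν = -λ m` gives
`∑ a j * φ j x = 0` over the eigenspace of `λ m` (`tsum_eigenspace_eq_zero`). The rank condition
makes all `a j` vanish, that is `dκ f² = 0`, and `f ≠ 0` almost everywhere.
-/

namespace Westervelt

/-! ### Sobolev embedding and point values -/

open FourierTransform in
/-- An `L²` function whose Fourier transform, as a tempered distribution, is the integrable function
`w` agrees almost everywhere with the inverse Fourier transform of `w`, which is continuous. -/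
lemma exists_continuous_of_fourier_memL1 {d : ℕ} (v : Lp ℂ 2 (volume : Measure (E d)))
    (w : Lp ℂ 1 (volume : Measure (E d)))
    (h : 𝓕 (v : 𝓢'(E d, ℂ)) = (w : 𝓢'(E d, ℂ))) :
    ∃ G : E d → ℂ, Continuous G ∧ v =ᵐ[volume] G := by
  have hw : Integrable (fun x => w (-x)) := (L1.integrable_coeFn w).comp_neg
  set G : E d → ℂ := VectorFourier.fourierIntegral Real.fourierChar volume (innerₗ (E d))
    (fun x => w (-x)) with hG
  have hGc : Continuous G :=
    VectorFourier.fourierIntegral_continuous Real.continuous_fourierChar continuous_inner hw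
  refine ⟨G, hGc, ?_⟩
  apply ae_eq_of_integral_contDiff_smul_eq
  · exact (Lp.memLp v).locallyIntegrable (by norm_num)
  · exact hGc.locallyIntegrable
  intro g g_smooth g_cpt
  have hg₁ : HasCompactSupport (Complex.ofRealCLM ∘ g) := g_cpt.comp_left rfl
  have hg₂ : ContDiff ℝ ∞ (Complex.ofRealCLM ∘ g) := by fun_prop
  set γ : 𝓢(E d, ℂ) := hg₁.toSchwartzMap hg₂ with hγ
  have hγx : ∀ x, γ x = (g x : ℂ) := fun x => rfl
  have h1 : (v : 𝓢'(E d, ℂ)) γ = (w : 𝓢'(E d, ℂ)) (𝓕⁻ γ) := by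
    rw [← h]; simp
  rw [Lp.toTemperedDistribution_apply, Lp.toTemperedDistribution_apply] at h1
  have h2 : ∫ x, (𝓕⁻ γ : 𝓢(E d, ℂ)) x • w x = ∫ x, (𝓕 γ : 𝓢(E d, ℂ)) x • w (-x) := by
    rw [← integral_neg_eq_self]
    congr 1
    ext x
    rw [SchwartzMap.fourierInv_coe, SchwartzMap.fourier_coe,
      Real.fourierInv_eq_fourier_neg, neg_neg]
  have h3 : ∫ x, (𝓕 γ : 𝓢(E d, ℂ)) x • w (-x) = ∫ x, γ x • G x := by
    simpa using! VectorFourier.integral_fourierIntegral_smul_eq_flip (L := innerₗ (E d))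
      Real.continuous_fourierChar continuous_inner γ.integrable hw
  calc ∫ x, g x • v x = ∫ x, γ x • v x := by simp [hγx]
    _ = ∫ x, γ x • G x := by rw [h1, h2, h3]
    _ = ∫ x, g x • G x := by simp [hγx]

/-- The Sobolev embedding `H²(Ω) ⊆ C(closure Ω)` in dimension at most three. -/
lemma MemH2.exists_continuous {d : ℕ} (hd : d ≤ 3) {Ω : Set (E d)} {u : L2 Ω} (hu : MemH2 Ω u) :
    ∃ g : E d → ℝ, Continuous g ∧ u =ᵐ[volume.restrict Ω] g := by
  obtain ⟨v, hv, hvu⟩ := hu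
  obtain ⟨w, hw⟩ := hv.fourier_memL1 (by
    rw [finrank_euclideanSpace_fin]
    have : (d : ℝ) ≤ 3 := by exact_mod_cast hd
    linarith)
  obtain ⟨G, hG, hvG⟩ := exists_continuous_of_fourier_memL1 v w hw
  refine ⟨fun x => (G x).re, Complex.continuous_re.comp hG, ?_⟩
  filter_upwards [hvu, ae_restrict_of_ae hvG] with x h1 h2
  rw [← h2, h1, Complex.ofReal_re]

/-- Functions that are continuous on the closure of an open set and agree almost everywhere on the
open set agree on the closure. -/
lemma eqOn_closure_of_ae_eq {d : ℕ} {Ω : Set (E d)} (hΩ : IsOpen Ω) {g₁ g₂ : E d → ℝ}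
    (h₁ : ContinuousOn g₁ (closure Ω)) (h₂ : ContinuousOn g₂ (closure Ω))
    (h : g₁ =ᵐ[volume.restrict Ω] g₂) : EqOn g₁ g₂ (closure Ω) := by
  have : EqOn g₁ g₂ Ω :=
    Measure.eqOn_open_of_ae_eq h hΩ (h₁.mono subset_closure) (h₂.mono subset_closure)
  exact this.of_subset_closure h₁ h₂ subset_closure subset_rfl

lemma pointValue_eq {d : ℕ} {Ω : Set (E d)} (hΩ : IsOpen Ω) {u : L2 Ω} {g : E d → ℝ}
    (hg : ContinuousOn g (closure Ω)) (hu : u =ᵐ[volume.restrict Ω] g) {x : E d}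
    (hx : x ∈ closure Ω) : pointValue Ω u x = g x := by
  have h : ∃ g : E d → ℝ, ContinuousOn g (closure Ω) ∧ u =ᵐ[volume.restrict Ω] g := ⟨g, hg, hu⟩
  rw [pointValue, dif_pos h]
  exact eqOn_closure_of_ae_eq hΩ h.choose_spec.1 hg (h.choose_spec.2.symm.trans hu) hx

/-! ### The eigenbasis and evaluation at a point -/

section Eigen

open Filter Topology

variable {H : Type*} [NormedAddCommGroup H] [InnerProductSpace ℝ H]
  {A : H →ₗ.[ℝ] H} {lam : ℕ → ℝ} {φ : HilbertBasis ℕ ℝ H}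

lemma inner_graph_comm [CompleteSpace H] (hA : IsSelfAdjoint A) {u v u' v' : H}
    (h : (u, v) ∈ A.graph) (h' : (u', v') ∈ A.graph) : inner ℝ v u' = inner ℝ u v' := by
  obtain ⟨x, rfl, rfl⟩ := (LinearPMap.mem_graph_iff A).1 h
  obtain ⟨y, rfl, rfl⟩ := (LinearPMap.mem_graph_iff A).1 h'
  have := LinearPMap.adjoint_isFormalAdjoint hA.dense_domain
  rw [LinearPMap.isSelfAdjoint_def.1 hA] at this
  exact this x y

lemma inner_basis_graph [CompleteSpace H] (hA : IsSelfAdjoint A)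
    (hφ : ∀ j, (φ j, lam j • φ j) ∈ A.graph) {u v : H} (h : (u, v) ∈ A.graph) (j : ℕ) :
    inner ℝ (φ j) v = lam j * inner ℝ (φ j) u := by
  rw [← inner_graph_comm hA (hφ j) h, real_inner_smul_left]

lemma sum_mem_graph (hφ : ∀ j, (φ j, lam j • φ j) ∈ A.graph) (F : Finset ℕ) (c : ℕ → ℝ) :
    (∑ j ∈ F, c j • φ j, ∑ j ∈ F, (lam j * c j) • φ j) ∈ A.graph := by
  have : (∑ j ∈ F, c j • φ j, ∑ j ∈ F, (lam j * c j) • φ j)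
      = ∑ j ∈ F, c j • (φ j, lam j • φ j) := by
    rw [Prod.ext_iff, Prod.fst_sum, Prod.snd_sum]
    simp [smul_smul, mul_comm]
  rw [this]
  exact Submodule.sum_mem _ fun j _ => Submodule.smul_mem _ _ (hφ j)

lemma hasSum_inner_smul (φ : HilbertBasis ℕ ℝ H) (u : H) :
    HasSum (fun j => (inner ℝ (φ j) u : ℝ) • φ j) u := by
  simpa [φ.repr_apply_apply] using φ.hasSum_repr u

/-- Membership in the graph can be tested on coefficients: the partial sums of the eigenfunction
expansions lie in the graph, which is closed. -/
lemma mem_graph_of_inner [CompleteSpace H] (hA : IsSelfAdjoint A)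
    (hφ : ∀ j, (φ j, lam j • φ j) ∈ A.graph) {u v : H}
    (h : ∀ j, inner ℝ (φ j) v = lam j * inner ℝ (φ j) u) : (u, v) ∈ A.graph := by
  have hc : _root_.IsClosed (A.graph : Set (H × H)) := hA.isClosed
  have hv := hasSum_inner_smul φ v
  simp only [h] at hv
  exact hc.mem_of_tendsto ((hasSum_inner_smul φ u).prodMk_nhds hv)
    (Eventually.of_forall fun F => sum_mem_graph hφ F _)

end Eigen

lemma IsEllipticRealisation.eigenvalue_pos {d : ℕ} {Ω : Set (E d)} {A : L2 Ω →ₗ.[ℝ] L2 Ω}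
    (hA : IsEllipticRealisation Ω A) {lam : ℕ → ℝ} {φ : HilbertBasis ℕ ℝ (L2 Ω)}
    (hφ : ∀ j, (φ j, lam j • φ j) ∈ A.graph) (j : ℕ) : 0 < lam j := by
  obtain ⟨x, hx, hAx⟩ := (LinearPMap.mem_graph_iff A).1 (hφ j)
  have hn : ‖φ j‖ = 1 := φ.orthonormal.1 j
  have h := hA.pos x (by
    rintro rfl
    simp only [ZeroMemClass.coe_zero] at hx
    rw [← hx, norm_zero] at hn
    exact zero_ne_one hn)
  rw [hAx, hx, real_inner_smul_left, real_inner_self_eq_norm_sq, hn] at h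
  simpa using h

section Evaluation

open Filter Topology

variable {d : ℕ} {Ω : Set (E d)} {A : L2 Ω →ₗ.[ℝ] L2 Ω} {lam : ℕ → ℝ}
  {φ : HilbertBasis ℕ ℝ (L2 Ω)}

lemma pointValue_spec (hd : d ≤ 3) (hΩ : IsOpen Ω) {u : L2 Ω} (hu : MemH2 Ω u) :
    ContinuousOn (pointValue Ω u) (closure Ω) ∧ u =ᵐ[volume.restrict Ω] pointValue Ω u := by
  obtain ⟨g, hg, hug⟩ := hu.exists_continuous hd
  have h : EqOn (pointValue Ω u) g (closure Ω) :=
    fun x hx => pointValue_eq hΩ hg.continuousOn hug hx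
  refine ⟨hg.continuousOn.congr h, hug.trans ?_⟩
  filter_upwards [ae_restrict_mem hΩ.measurableSet] with x hx
  exact (h (subset_closure hx)).symm

lemma pointValue_add_smul (hd : d ≤ 3) (hΩ : IsOpen Ω) {u v : L2 Ω} (hu : MemH2 Ω u)
    (hv : MemH2 Ω v) (r : ℝ) {x : E d} (hx : x ∈ closure Ω) :
    pointValue Ω (u + r • v) x = pointValue Ω u x + r * pointValue Ω v x := by
  obtain ⟨hu₁, hu₂⟩ := pointValue_spec hd hΩ hu
  obtain ⟨hv₁, hv₂⟩ := pointValue_spec hd hΩ hv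
  refine pointValue_eq hΩ (g := fun y => pointValue Ω u y + r * pointValue Ω v y)
    (hu₁.add (continuousOn_const.mul hv₁)) ?_ hx
  filter_upwards [Lp.coeFn_add u (r • v), Lp.coeFn_smul r v, hu₂, hv₂] with y h1 h2 h3 h4
  rw [h1, Pi.add_apply, h2, Pi.smul_apply, smul_eq_mul, ← h3, ← h4]

/-- The graph of `A`, which carries the graph norm, mapped to the continuous representatives on the
compact set `closure Ω`. -/
noncomputable def graphToContinuous (hd : d ≤ 3) (hΩ : IsOpen Ω) (hA : IsEllipticRealisation Ω A) :
    A.graph →ₗ[ℝ] C(closure Ω, ℝ) where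
  toFun p := ⟨fun x => pointValue Ω p.1.1 x,
    (pointValue_spec hd hΩ (hA.domain_H2 _ (LinearPMap.mem_domain_of_mem_graph p.2))).1.domRestrict⟩
  map_add' p q := by
    ext x
    have := pointValue_add_smul hd hΩ (hA.domain_H2 _ (LinearPMap.mem_domain_of_mem_graph p.2))
      (hA.domain_H2 _ (LinearPMap.mem_domain_of_mem_graph q.2)) 1 x.2
    simpa using! this
  map_smul' r p := by
    ext x
    have h0 : MemH2 Ω 0 := hA.domain_H2 _ A.domain.zero_mem
    have h1 := pointValue_add_smul hd hΩ h0
      (hA.domain_H2 _ (LinearPMap.mem_domain_of_mem_graph p.2)) r x.2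
    have h2 : pointValue Ω (0 : L2 Ω) x = 0 :=
      pointValue_eq hΩ continuousOn_const (Lp.coeFn_zero _ _ _) x.2
    rw [zero_add, h2, zero_add] at h1
    simpa using! h1

/-- By the closed graph theorem, evaluation on `closure Ω` is continuous for the graph norm: a limit
in `L²` and a uniform limit of the same sequence agree almost everywhere. -/
lemma continuous_graphToContinuous (hd : d ≤ 3) (hΩ : IsOpen Ω) (hΩb : Bornology.IsBounded Ω)
    (hA : IsEllipticRealisation Ω A) : Continuous (graphToContinuous hd hΩ hA) := by
  have hK : CompactSpace (closure Ω) := isCompact_iff_compactSpace.1 hΩb.isCompact_closure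
  have hc : _root_.IsClosed (A.graph : Set (L2 Ω × L2 Ω)) := hA.selfAdjoint.isClosed
  have : CompleteSpace A.graph := hc.completeSpace_coe
  apply LinearMap.continuous_of_seq_closed_graph
  intro u x y hu hy
  have hu1 : Tendsto (fun n => (u n).1.1) atTop (𝓝 x.1.1) :=
    ((continuous_fst.comp continuous_subtype_val).tendsto x).comp hu
  obtain ⟨ns, hns, hae⟩ := (tendstoInMeasure_of_tendsto_Lp hu1).exists_seq_tendsto_ae
  have hall : ∀ᵐ z ∂(volume.restrict Ω), ∀ n, (u n).1.1 z = pointValue Ω (u n).1.1 z :=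
    ae_all_iff.2 fun n =>
      (pointValue_spec hd hΩ (hA.domain_H2 _ (LinearPMap.mem_domain_of_mem_graph (u n).2))).2
  obtain ⟨h1, h2⟩ :=
    pointValue_spec hd hΩ (hA.domain_H2 _ (LinearPMap.mem_domain_of_mem_graph x.2))
  classical
  set Y : E d → ℝ := fun z => if hz : z ∈ closure Ω then y ⟨z, hz⟩ else 0 with hY
  have hYc : ContinuousOn Y (closure Ω) := by
    rw [continuousOn_iff_continuous_domRestrict]
    have : (closure Ω).domRestrict Y = y := by
      ext z; simp [hY, domRestrict_apply]
    rw [this]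
    exact y.continuous
  have hxY : x.1.1 =ᵐ[volume.restrict Ω] Y := by
    filter_upwards [hae, hall, ae_restrict_mem hΩ.measurableSet] with z hz1 hz2 hz3
    refine tendsto_nhds_unique hz1 ?_
    have hz4 : z ∈ closure Ω := subset_closure hz3
    have h5 : Tendsto (fun n => (graphToContinuous hd hΩ hA (u n)) ⟨z, hz4⟩) atTop
        (𝓝 (y ⟨z, hz4⟩)) := ((continuous_eval_const _).tendsto y).comp hy
    have h6 := h5.comp hns.tendsto_atTop
    simp only [hY, dif_pos hz4, hz2]
    exact h6
  ext z
  change y z = pointValue Ω x.1.1 z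
  rw [pointValue_eq hΩ hYc hxY z.2]
  simp [hY]

/-- Evaluation at `x` is an `ℓ²` functional in the coordinates `(1 + lam j) * ⟪φ j, u⟫`. -/
theorem summable_sq_pointValue (hd : d ≤ 3) (hΩ : IsOpen Ω) (hΩb : Bornology.IsBounded Ω)
    (hA : IsEllipticRealisation Ω A) (hφ : ∀ j, (φ j, lam j • φ j) ∈ A.graph) {x : E d}
    (hx : x ∈ closure Ω) : Summable fun j => (pointValue Ω (φ j) x / (1 + lam j)) ^ 2 := by
  have hK : CompactSpace (closure Ω) := isCompact_iff_compactSpace.1 hΩb.isCompact_closure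
  have hl := hA.eigenvalue_pos hφ
  have hC0 := norm_nonneg (⟨graphToContinuous hd hΩ hA,
    continuous_graphToContinuous hd hΩ hΩb hA⟩ : A.graph →L[ℝ] C(closure Ω, ℝ))
  have hC := (⟨graphToContinuous hd hΩ hA,
    continuous_graphToContinuous hd hΩ hΩb hA⟩ : A.graph →L[ℝ] C(closure Ω, ℝ)).le_opNorm
  set C := ‖(⟨graphToContinuous hd hΩ hA,
    continuous_graphToContinuous hd hΩ hΩb hA⟩ : A.graph →L[ℝ] C(closure Ω, ℝ))‖
  set h : ℕ → ℝ := fun j => pointValue Ω (φ j) x / (1 + lam j) with hh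
  refine summable_of_sum_le (c := C ^ 2) (fun j => sq_nonneg _) fun F => ?_
  -- the value at `x` of the combination with these coefficients is the partial sum of squares,
  -- and its graph norm is at most the square root of that sum
  set c : ℕ → ℝ := fun j => h j / (1 + lam j) with hcdef
  set p : A.graph := ⟨_, sum_mem_graph hφ F c⟩ with hp
  have hval : graphToContinuous hd hΩ hA p ⟨x, hx⟩ = ∑ j ∈ F, h j ^ 2 := by
    have : p = ∑ j ∈ F, c j • (⟨_, hφ j⟩ : A.graph) := by
      apply Subtype.ext
      rw [Submodule.coe_sum, Prod.ext_iff, Prod.fst_sum, Prod.snd_sum]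
      simp [hp, smul_smul, mul_comm]
    rw [this, map_sum, ContinuousMap.sum_apply]
    refine Finset.sum_congr rfl fun j _ => ?_
    rw [map_smul, ContinuousMap.smul_apply]
    change c j • pointValue Ω (φ j) x = _
    have := hl j
    simp only [hcdef, hh, smul_eq_mul]
    field_simp
  have hnorm : ∀ e : ℕ → ℝ, (∀ j, |e j| ≤ |h j|) →
      ‖∑ j ∈ F, e j • φ j‖ ≤ √(∑ j ∈ F, h j ^ 2) := by
    intro e he
    apply Real.le_sqrt_of_sq_le
    rw [← real_inner_self_eq_norm_sq, φ.orthonormal.inner_sum]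
    simp only [conj_trivial]
    refine Finset.sum_le_sum fun j _ => ?_
    rw [← pow_two]
    exact sq_le_sq.2 (he j)
  have hpn : ‖p‖ ≤ √(∑ j ∈ F, h j ^ 2) := by
    refine max_le (hnorm _ fun j => ?_) (hnorm _ fun j => ?_)
    · have := hl j
      rw [hcdef, abs_div, abs_of_pos (by linarith : 0 < 1 + lam j)]
      exact div_le_self (abs_nonneg _) (by linarith)
    · have := hl j
      rw [hcdef, abs_mul, abs_div, abs_of_pos (by linarith : 0 < 1 + lam j), abs_of_pos this,
        mul_div_left_comm]
      exact mul_le_of_le_one_right (abs_nonneg _) ((div_le_one (by linarith)).2 (by linarith))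
  have h1 : ∑ j ∈ F, h j ^ 2 ≤ C * √(∑ j ∈ F, h j ^ 2) := by
    rw [← hval]
    calc _ ≤ ‖graphToContinuous hd hΩ hA p ⟨x, hx⟩‖ := le_abs_self _
      _ ≤ ‖graphToContinuous hd hΩ hA p‖ := ContinuousMap.norm_coe_le_norm _ _
      _ ≤ C * ‖p‖ := hC p
      _ ≤ _ := by rw [hval]; gcongr
  have h0 : 0 ≤ ∑ j ∈ F, h j ^ 2 := Finset.sum_nonneg fun j _ => sq_nonneg _
  have h2 := Real.sq_sqrt h0
  have h3 := Real.sqrt_nonneg (∑ j ∈ F, h j ^ 2)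
  change ∑ j ∈ F, h j ^ 2 ≤ C ^ 2
  rcases h3.eq_or_lt with h4 | h4
  · rw [← h2, ← h4]; simpa using sq_nonneg C
  · have : √(∑ j ∈ F, h j ^ 2) ≤ C := by
      by_contra hcon
      push Not at hcon
      nlinarith
    rw [← h2]; gcongr

/-- Elements of the domain of `A` are the pointwise sums of their eigenfunction expansions. -/
theorem hasSum_pointValue (hd : d ≤ 3) (hΩ : IsOpen Ω) (hΩb : Bornology.IsBounded Ω)
    (hA : IsEllipticRealisation Ω A) (hφ : ∀ j, (φ j, lam j • φ j) ∈ A.graph) {x : E d}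
    (hx : x ∈ closure Ω) {u v : L2 Ω} (huv : (u, v) ∈ A.graph) :
    HasSum (fun j => inner ℝ (φ j) u * pointValue Ω (φ j) x) (pointValue Ω u x) := by
  have hK : CompactSpace (closure Ω) := isCompact_iff_compactSpace.1 hΩb.isCompact_closure
  have hv := hasSum_inner_smul φ v
  simp only [inner_basis_graph hA.selfAdjoint hφ huv] at hv
  have hs : HasSum (fun j => (inner ℝ (φ j) u : ℝ) • (⟨_, hφ j⟩ : A.graph)) ⟨_, huv⟩ := by
    rw [HasSum, tendsto_subtype_rng]
    refine ((hasSum_inner_smul φ u).prodMk_nhds hv).congr fun F => ?_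
    rw [Submodule.coe_sum, Prod.ext_iff, Prod.fst_sum, Prod.snd_sum]
    simp [smul_smul, mul_comm]
  have h1 := hs.map (graphToContinuous hd hΩ hA) (continuous_graphToContinuous hd hΩ hΩb hA)
  refine (h1.map (ContinuousMap.evalCLM ℝ (⟨x, hx⟩ : closure Ω))
    (ContinuousMap.evalCLM ℝ (⟨x, hx⟩ : closure Ω)).continuous).congr_fun fun j => ?_
  simp only [Function.comp_apply, map_smul, smul_eq_mul]
  rfl

end Evaluation

/-! ### Quotients of bounded holomorphic functions on the disc -/

section Disc

open Metric Filter Topology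

/-- Harnack's inequality for `log ‖G‖` of a zero-free bounded holomorphic function `G`. -/
lemma norm_ge_of_ne_zero_on_ball {r C M : ℝ} (hr : 0 < r) (hM : 0 < M) {G : ℂ → ℂ}
    (hG : DifferentiableOn ℂ G (ball 0 r)) (h0 : ∀ z ∈ ball (0 : ℂ) r, G z ≠ 0)
    (hC : ∀ z ∈ ball (0 : ℂ) r, ‖G z‖ ≤ C) (hCM : C ≤ ‖G 0‖ * Real.exp M)
    {w : ℂ} (hw : w ∈ ball (0 : ℂ) r) :
    ‖G 0‖ * Real.exp (-(2 * M * ‖w‖ / (r - ‖w‖))) ≤ ‖G w‖ := by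
  have hB : IsOpen (ball (0 : ℂ) r) := isOpen_ball
  have hm0 : (0 : ℂ) ∈ ball (0 : ℂ) r := mem_ball_self hr
  obtain ⟨h, hh0, hh⟩ := (((hG.deriv hB).div hG h0).isExactOn_ball).with_val_at 0 0
  -- `G * exp (-h)` has vanishing derivative
  have hd : ∀ z ∈ ball (0 : ℂ) r, HasDerivAt (fun z => G z * Complex.exp (-h z)) 0 z := by
    intro z hz
    have h1 := ((hG.differentiableAt (hB.mem_nhds hz)).hasDerivAt).mul ((hh z hz).neg.cexp)
    have h2 : (0 : ℂ) = deriv G z * Complex.exp ((-h) z)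
        + G z * (Complex.exp ((-h) z) * -(deriv G / G) z) := by
      have := h0 z hz
      rw [Pi.div_apply]
      field_simp
      ring
    rw [h2]
    exact h1
  have hconst : ∀ z ∈ ball (0 : ℂ) r, G z * Complex.exp (-h z) = G 0 := by
    intro z hz
    have h2 := (convex_ball (0 : ℂ) r).is_const_of_fderivWithin_eq_zero (𝕜 := ℂ)
      (f := fun z => G z * Complex.exp (-h z))
      (fun y hy => (hd y hy).differentiableAt.differentiableWithinAt)
      (fun y hy => by
        rw [fderivWithin_of_isOpen hB hy]
        ext
        simp [(hd y hy).hasFDerivAt.fderiv]) hz hm0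
    simpa [hh0] using h2
  have hexp : ∀ z ∈ ball (0 : ℂ) r, ‖G z‖ = ‖G 0‖ * Real.exp (h z).re := by
    intro z hz
    rw [← hconst z hz, norm_mul, Complex.norm_exp, mul_assoc, ← Real.exp_add]
    simp
  have hG0 : 0 < ‖G 0‖ := norm_pos_iff.2 (h0 0 hm0)
  have hbc := Complex.borelCaratheodory_zero hM
    (fun z hz => (hh z hz).differentiableAt.differentiableWithinAt) (R := r)
    (fun z hz => by
      have h3 := (hC z hz).trans hCM
      rw [hexp z hz] at h3
      exact Real.exp_le_exp.1 (le_of_mul_le_mul_left h3 hG0)) hr hw hh0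
  rw [hexp w hw]
  have h4 := (abs_le.1 ((Complex.abs_re_le_norm (h w)).trans hbc)).1
  gcongr

/-- The zeros of `g` in the closed disc can be removed without changing `‖g‖` on the circle and
without decreasing it at the centre: each factor `z - u` is replaced by `(r ^ 2 - conj u * z) / r`,
which has the same modulus on the circle. -/
lemma exists_zero_free_on_ball {r : ℝ} (hr : 0 < r) {g : ℂ → ℂ}
    (hg : AnalyticOnNhd ℂ g (closedBall 0 r)) (h0 : g 0 ≠ 0) :
    ∃ G : ℂ → ℂ, AnalyticOnNhd ℂ G (closedBall 0 r) ∧ (∀ z ∈ ball (0 : ℂ) r, G z ≠ 0) ∧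
      (∀ z ∈ sphere (0 : ℂ) r, ‖G z‖ = ‖g z‖) ∧ ‖g 0‖ ≤ ‖G 0‖ := by
  have hm0 : (0 : ℂ) ∈ closedBall (0 : ℂ) r := mem_closedBall_self hr.le
  have hconn : IsPreconnected (closedBall (0 : ℂ) r) := (convex_closedBall 0 r).isPreconnected
  have htop : ∀ u : closedBall (0 : ℂ) r, meromorphicOrderAt g u ≠ ⊤ := by
    intro u
    have h1 : analyticOrderAt g u ≠ ⊤ := by
      refine hg.analyticOrderAt_ne_top_of_isPreconnected hconn hm0 u.2 ?_
      rw [(hg 0 hm0).analyticOrderAt_eq_zero.2 h0]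
      simp
    rw [(hg u u.2).meromorphicOrderAt_eq]
    simpa using h1
  set D := MeromorphicOn.divisor g (closedBall 0 r) with hD
  have hfin : D.support.Finite := D.finiteSupport (isCompact_closedBall 0 r)
  obtain ⟨G, hG, hG0, hgG⟩ := hg.meromorphicOn.extract_zeros_poles htop hfin
  have hDn : 0 ≤ D := MeromorphicOn.AnalyticOnNhd.divisor_nonneg hg
  have hprod : (∏ᶠ u, (fun z : ℂ => z - u) ^ D u)
      = fun z => ∏ u ∈ hfin.toFinset, (z - u) ^ (D u).toNat := by
    rw [finprod_eq_prod_of_mulSupport_subset (s := hfin.toFinset)]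
    · ext z
      rw [Finset.prod_apply]
      refine Finset.prod_congr rfl fun u _ => ?_
      rw [Pi.pow_apply]
      conv_lhs => rw [← Int.toNat_of_nonneg (hDn u)]
      rw [zpow_natCast]
    · rw [Function.FactorizedRational.mulSupport]; simp
  rw [hprod] at hgG
  set P : ℂ → ℂ := fun z => ∏ u ∈ hfin.toFinset, (z - u) ^ (D u).toNat with hP
  have hPan : AnalyticOnNhd ℂ P univ :=
    (Differentiable.differentiableOn (by fun_prop)).analyticOnNhd isOpen_univ
  have heq : EqOn g (P * G) (closedBall 0 r) := by
    rcases hg.eqOn_or_eventually_ne_of_preconnected ((hPan.mono (subset_univ _)).mul hG) hconn with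
      h | h
    · exact h
    · exfalso
      have h1 : ∀ᶠ x in codiscreteWithin (closedBall (0 : ℂ) r), False := by
        filter_upwards [h, hgG] with x hx hx'
        exact hx hx'
      rw [eventually_false_iff_eq_bot] at h1
      have h2 : (∅ : Set ℂ) ∈ codiscreteWithin (closedBall (0 : ℂ) r) := by rw [h1]; trivial
      rw [mem_codiscreteWithin_iff_forall_mem_nhdsNE] at h2
      have h3 := h2 0 hm0
      have h4 : closedBall (0 : ℂ) r ∈ 𝓝[≠] (0 : ℂ) :=
        mem_nhdsWithin_of_mem_nhds (closedBall_mem_nhds 0 hr)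
      have h5 := inter_mem h3 h4
      simp at h5
  have hDu : ∀ u ∈ hfin.toFinset, ‖u‖ ≤ r := by
    intro u hu
    have : u ∈ closedBall (0 : ℂ) r := D.supportWithinDomain ((hfin.mem_toFinset).1 hu)
    simpa using this
  have hrC : (r : ℂ) ≠ 0 := by exact_mod_cast hr.ne'
  set Q : ℂ → ℂ := fun z =>
    ∏ u ∈ hfin.toFinset, ((r ^ 2 - (starRingEnd ℂ) u * z) / r) ^ (D u).toNat with hQ
  refine ⟨Q * G, ?_, ?_, ?_, ?_⟩
  · have hQan : AnalyticOnNhd ℂ Q univ :=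
      (Differentiable.differentiableOn (by fun_prop)).analyticOnNhd isOpen_univ
    exact (hQan.mono (subset_univ _)).mul hG
  · intro z hz
    refine mul_ne_zero ?_ (hG0 ⟨z, ball_subset_closedBall hz⟩)
    refine Finset.prod_ne_zero_iff.2 fun u hu => pow_ne_zero _ (div_ne_zero ?_ hrC)
    intro hcon
    have h1 : ‖(r : ℂ) ^ 2‖ = ‖(starRingEnd ℂ) u * z‖ := by rw [sub_eq_zero.1 hcon]
    have hz' : ‖z‖ < r := by simpa using hz
    rw [norm_mul, RCLike.norm_conj, norm_pow, Complex.norm_real, Real.norm_of_nonneg hr.le] at h1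
    have h2 := hDu u hu
    nlinarith [norm_nonneg u, norm_nonneg z]
  · intro z hz
    have hz' : ‖z‖ = r := by simpa using hz
    rw [heq (sphere_subset_closedBall hz), Pi.mul_apply, Pi.mul_apply, norm_mul, norm_mul]
    congr 1
    simp only [hQ, hP, norm_prod, norm_pow]
    refine Finset.prod_congr rfl fun u _ => ?_
    congr 1
    have h1 : (r : ℂ) ^ 2 - (starRingEnd ℂ) u * z = z * (starRingEnd ℂ) (z - u) := by
      rw [map_sub, mul_sub, Complex.mul_conj, Complex.normSq_eq_norm_sq, hz']
      push_cast
      ring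
    rw [h1, norm_div, norm_mul, RCLike.norm_conj, hz', Complex.norm_real,
      Real.norm_of_nonneg hr.le]
    field_simp
  · rw [heq hm0, Pi.mul_apply, Pi.mul_apply, norm_mul, norm_mul]
    refine mul_le_mul_of_nonneg_right ?_ (norm_nonneg _)
    simp only [hQ, hP, norm_prod, norm_pow]
    refine Finset.prod_le_prod (fun u _ => by positivity) fun u hu => ?_
    have h1 : ‖((r : ℂ) ^ 2 - (starRingEnd ℂ) u * 0) / r‖ = r := by
      rw [mul_zero, sub_zero, pow_two, mul_div_cancel_right₀ _ hrC, Complex.norm_real,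
        Real.norm_of_nonneg hr.le]
    rw [h1, zero_sub, norm_neg]
    exact pow_le_pow_left₀ (norm_nonneg _) (hDu u hu) _

/-- A holomorphic quotient `p = (p * g) / g` of bounded functions on the unit disc has bounded
characteristic, hence grows at most like `exp (K / (1 - ‖w‖))`. -/
theorem norm_le_exp_of_bounded_quotient {p g : ℂ → ℂ} {C : ℝ}
    (hp : DifferentiableOn ℂ p (ball 0 1)) (hg : DifferentiableOn ℂ g (ball 0 1))
    (hgC : ∀ z ∈ ball (0 : ℂ) 1, ‖g z‖ ≤ C) (hpg : ∀ z ∈ ball (0 : ℂ) 1, ‖p z * g z‖ ≤ C)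
    (h0 : g 0 ≠ 0) :
    ∃ K : ℝ, 0 < K ∧ ∀ w ∈ ball (0 : ℂ) 1, ‖p w‖ ≤ K * Real.exp (K / (1 - ‖w‖)) := by
  have hg0 : 0 < ‖g 0‖ := norm_pos_iff.2 h0
  have hC : 0 < C := hg0.trans_le (hgC 0 (mem_ball_self one_pos))
  set M : ℝ := max 1 (Real.log (C / ‖g 0‖)) with hM
  have hM0 : 0 < M := lt_of_lt_of_le one_pos (le_max_left _ _)
  have hCM : C ≤ ‖g 0‖ * Real.exp M := by
    calc C = ‖g 0‖ * Real.exp (Real.log (C / ‖g 0‖)) := by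
          rw [Real.exp_log (by positivity)]; field_simp
      _ ≤ _ := by gcongr; exact le_max_right _ _
  have hmain : ∀ r : ℝ, 0 < r → r < 1 → ∀ w ∈ ball (0 : ℂ) r,
      ‖p w‖ ≤ C / ‖g 0‖ * Real.exp (2 * M * ‖w‖ / (r - ‖w‖)) := by
    intro r hr hr1 w hw
    have hsub : closedBall (0 : ℂ) r ⊆ ball 0 1 := closedBall_subset_ball hr1
    have hga : AnalyticOnNhd ℂ g (closedBall 0 r) := (hg.analyticOnNhd isOpen_ball).mono hsub
    have hpa : AnalyticOnNhd ℂ p (closedBall 0 r) := (hp.analyticOnNhd isOpen_ball).mono hsub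
    obtain ⟨G, hG, hGne, hGs, hG0⟩ := exists_zero_free_on_ball hr hga h0
    have hmax : ∀ q : ℂ → ℂ, AnalyticOnNhd ℂ q (closedBall 0 r) →
        (∀ z ∈ sphere (0 : ℂ) r, ‖q z‖ ≤ C) → ∀ z ∈ ball (0 : ℂ) r, ‖q z‖ ≤ C := by
      intro q hq hqs z hz
      refine Complex.norm_le_of_forall_mem_frontier_norm_le isBounded_ball
        (DifferentiableOn.diffContOnCl ?_) ?_ (subset_closure hz)
      · rw [closure_ball _ hr.ne']; exact hq.differentiableOn
      · rw [frontier_ball _ hr.ne']; exact hqs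
    have h1 : ∀ z ∈ ball (0 : ℂ) r, ‖G z‖ ≤ C := hmax G hG fun z hz => by
      rw [hGs z hz]; exact hgC z (hsub (sphere_subset_closedBall hz))
    have h2 : ∀ z ∈ ball (0 : ℂ) r, ‖(p * G) z‖ ≤ C := hmax _ (hpa.mul hG) fun z hz => by
      rw [Pi.mul_apply, norm_mul, hGs z hz, ← norm_mul]
      exact hpg z (hsub (sphere_subset_closedBall hz))
    have h3 := norm_ge_of_ne_zero_on_ball hr hM0 (hG.differentiableOn.mono ball_subset_closedBall)
      hGne h1 (hCM.trans (by gcongr)) hw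
    have h4 := h2 w hw
    rw [Pi.mul_apply, norm_mul] at h4
    have h5 : 0 < ‖g 0‖ * Real.exp (-(2 * M * ‖w‖ / (r - ‖w‖))) := by positivity
    have h6 : ‖g 0‖ * Real.exp (-(2 * M * ‖w‖ / (r - ‖w‖))) ≤ ‖G w‖ :=
      le_trans (by gcongr) h3
    have h7 : ‖p w‖ * (‖g 0‖ * Real.exp (-(2 * M * ‖w‖ / (r - ‖w‖)))) ≤ C :=
      (mul_le_mul_of_nonneg_left h6 (norm_nonneg _)).trans h4
    rw [← le_div_iff₀ h5, Real.exp_neg] at h7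
    refine h7.trans (le_of_eq ?_)
    field_simp
  refine ⟨max (C / ‖g 0‖) (2 * M), lt_max_of_lt_right (by positivity), fun w hw => ?_⟩
  have hw1 : ‖w‖ < 1 := by simpa using hw
  have hw1' : 0 < 1 - ‖w‖ := by linarith
  -- the constants do not depend on the radius, which can therefore be sent to `1`
  have hlim : Tendsto (fun r : ℝ => C / ‖g 0‖ * Real.exp (2 * M * ‖w‖ / (r - ‖w‖))) (𝓝[<] 1)
      (𝓝 (C / ‖g 0‖ * Real.exp (2 * M * ‖w‖ / (1 - ‖w‖)))) := by
    have : ContinuousAt (fun r : ℝ => C / ‖g 0‖ * Real.exp (2 * M * ‖w‖ / (r - ‖w‖))) 1 := by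
      have := hw1'.ne'
      fun_prop (disch := assumption)
    exact this.tendsto.mono_left nhdsWithin_le_nhds
  have hle : ‖p w‖ ≤ C / ‖g 0‖ * Real.exp (2 * M * ‖w‖ / (1 - ‖w‖)) := by
    refine ge_of_tendsto hlim ?_
    filter_upwards [Ioo_mem_nhdsLT hw1] with r hr
    exact hmain r ((norm_nonneg w).trans_lt hr.1) hr.2 w (by simpa using hr.1)
  refine hle.trans ?_
  gcongr
  · exact le_max_left _ _
  · calc 2 * M * ‖w‖ ≤ 2 * M * 1 := by gcongr
      _ ≤ _ := by rw [mul_one]; exact le_max_right _ _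

end Disc

/-! ### Entire functions that are bounded quotients in a sector -/

section Sector

open Metric Filter Topology

/-- In the sector `Re s ≥ -(3 / 4) * ‖s‖`, adding a nonnegative real number causes no
cancellation. -/
lemma norm_add_ge_of_sector {s : ℂ} (hs : -(3 / 4) * ‖s‖ ≤ s.re) {μ : ℝ} (hμ : 0 ≤ μ) :
    (‖s‖ + μ) / 3 ≤ ‖s + μ‖ := by
  have h1 : ‖s + μ‖ ^ 2 = ‖s‖ ^ 2 + 2 * μ * s.re + μ ^ 2 := by
    rw [← Complex.normSq_eq_norm_sq, ← Complex.normSq_eq_norm_sq, Complex.normSq_apply,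
      Complex.normSq_apply]
    simp
    ring
  have h2 := norm_nonneg s
  refine le_of_sq_le_sq ?_ (norm_nonneg _)
  rw [h1]
  nlinarith [mul_le_mul_of_nonneg_left hs hμ, sq_nonneg (‖s‖ - μ)]

/-- The power `3 / 2` opens the right half plane to a sector of half angle `3 * π / 4`. -/
lemma re_cpow_three_halves {ζ : ℂ} (hζ : 0 < ζ.re) :
    -(3 / 4) * ‖ζ ^ ((3 / 2 : ℝ) : ℂ)‖ ≤ (ζ ^ ((3 / 2 : ℝ) : ℂ)).re := by
  have harg := Complex.abs_arg_lt_pi_div_two_iff.2 (Or.inl hζ)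
  have hcos : -(3 / 4) ≤ Real.cos (ζ.arg * (3 / 2)) := by
    rw [← Real.cos_abs, abs_mul, abs_of_pos (by norm_num : (0 : ℝ) < 3 / 2)]
    have h1 : Real.cos (3 * Real.pi / 4) ≤ Real.cos (|ζ.arg| * (3 / 2)) := by
      have := Real.pi_pos
      apply Real.cos_le_cos_of_nonneg_of_le_pi (by positivity) <;> linarith
    have h2 : Real.cos (3 * Real.pi / 4) = -(√2 / 2) := by
      rw [show 3 * Real.pi / 4 = Real.pi - Real.pi / 4 by ring, Real.cos_pi_sub,
        Real.cos_pi_div_four]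
    have h3 : √2 ≤ 3 / 2 := by
      rw [Real.sqrt_le_left (by norm_num)]; norm_num
    linarith
  rw [Complex.norm_cpow_real, Complex.cpow_ofReal_re]
  have := Real.rpow_nonneg (norm_nonneg ζ) (3 / 2)
  nlinarith

/-- If the bounded function `g` does not vanish identically on a sector of opening larger than `π`
and `P * g` is bounded there, then `P` grows subexponentially along the positive real axis. -/
theorem norm_le_exp_of_bounded_quotient_sector {P g : ℂ → ℂ} {R C : ℝ} (hR : 0 < R)
    (hP : Differentiable ℂ P)
    (hg : ∀ s : ℂ, -(3 / 4) * ‖s‖ < s.re → R / 3 < ‖s‖ →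
      DifferentiableAt ℂ g s ∧ ‖g s‖ ≤ C ∧ ‖P s * g s‖ ≤ C)
    (hg0 : g (R + 1 : ℝ) ≠ 0) :
    ∃ K : ℝ, 0 < K ∧ ∀ t : ℝ, 1 ≤ t → ‖P (R + t ^ 3 : ℝ)‖ ≤ K * Real.exp (K * (t ^ 2 + 1)) := by
  -- the disc is mapped to the right half plane by `(1 + w) / (1 - w)`
  set ζ : ℂ → ℂ := fun w => (1 + w) / (1 - w) with hζ
  have hne : ∀ w ∈ ball (0 : ℂ) 1, 1 - w ≠ 0 := by
    intro w hw h
    rw [sub_eq_zero] at h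
    simp [← h] at hw
  have hζre : ∀ w ∈ ball (0 : ℂ) 1, 0 < (ζ w).re := by
    intro w hw
    have h1 : 0 < Complex.normSq (1 - w) := Complex.normSq_pos.2 (hne w hw)
    have h2 : ‖w‖ ^ 2 < 1 := by
      have : ‖w‖ < 1 := by simpa using hw
      nlinarith [norm_nonneg w]
    rw [← Complex.normSq_eq_norm_sq, Complex.normSq_apply] at h2
    simp only [hζ, Complex.div_re]
    rw [← add_div]
    apply div_pos _ h1
    simp only [Complex.add_re, Complex.one_re, Complex.sub_re, Complex.add_im, Complex.one_im,
      Complex.sub_im]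
    nlinarith
  -- and from there to a translate of the sector of half angle `3 * π / 4`
  set Φ : ℂ → ℂ := fun w => (R : ℂ) + ζ w ^ ((3 / 2 : ℝ) : ℂ) with hΦ
  have hΦd : ∀ w ∈ ball (0 : ℂ) 1, DifferentiableAt ℂ Φ w := by
    intro w hw
    have h1 : DifferentiableAt ℂ ζ w :=
      ((differentiableAt_const _).add differentiableAt_id).div
        ((differentiableAt_const _).sub differentiableAt_id) (hne w hw)
    exact (differentiableAt_const _).add
      (h1.cpow (differentiableAt_const _) (Or.inl (hζre w hw)))
  have hΦs : ∀ w ∈ ball (0 : ℂ) 1, -(3 / 4) * ‖Φ w‖ < (Φ w).re ∧ R / 3 < ‖Φ w‖ := by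
    intro w hw
    have h1 := re_cpow_three_halves (hζre w hw)
    set η := ζ w ^ ((3 / 2 : ℝ) : ℂ) with hη
    have h2 : Φ w = η + (R : ℂ) := by simp only [hΦ]; ring
    have h3 := norm_add_ge_of_sector h1 hR.le
    have h4 : 0 < ‖η‖ := by
      rw [hη, Complex.norm_cpow_real]
      refine Real.rpow_pos_of_pos (norm_pos_iff.2 fun h => ?_) _
      have := hζre w hw
      simp [h] at this
    rw [h2]
    constructor
    · have h5 : ‖η‖ ≤ ‖η + (R : ℂ)‖ + R := by
        calc ‖η‖ = ‖η + R - R‖ := by ring_nf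
          _ ≤ ‖η + R‖ + ‖(R : ℂ)‖ := norm_sub_le _ _
          _ = _ := by rw [Complex.norm_real, Real.norm_of_nonneg hR.le]
      simp only [Complex.add_re, Complex.ofReal_re]
      linarith
    · linarith
  have hΦreal : ∀ t : ℝ, 1 ≤ t → Φ (((t ^ 2 - 1) / (t ^ 2 + 1) : ℝ) : ℂ) = (R + t ^ 3 : ℝ) := by
    intro t ht
    have h1 : ζ (((t ^ 2 - 1) / (t ^ 2 + 1) : ℝ) : ℂ) = ((t ^ 2 : ℝ) : ℂ) := by
      have h2 : (1 + (t ^ 2 - 1) / (t ^ 2 + 1)) / (1 - (t ^ 2 - 1) / (t ^ 2 + 1)) = t ^ 2 := by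
        have : t ^ 2 + 1 ≠ 0 := by positivity
        field_simp
        ring
      simp only [hζ]
      exact_mod_cast congrArg Complex.ofReal h2
    simp only [hΦ]
    rw [h1, ← Complex.ofReal_cpow (by positivity), ← Real.rpow_natCast,
      ← Real.rpow_mul (by linarith)]
    push_cast
    norm_num
  obtain ⟨K, hK, hKb⟩ := norm_le_exp_of_bounded_quotient (p := P ∘ Φ) (g := g ∘ Φ) (C := C)
    (fun w hw => ((hP _).comp w (hΦd w hw)).differentiableWithinAt)
    (fun w hw => ((hg _ (hΦs w hw).1 (hΦs w hw).2).1.comp w (hΦd w hw)).differentiableWithinAt)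
    (fun w hw => (hg _ (hΦs w hw).1 (hΦs w hw).2).2.1)
    (fun w hw => (hg _ (hΦs w hw).1 (hΦs w hw).2).2.2)
    (by
      have := hΦreal 1 le_rfl
      norm_num at this
      rw [Function.comp_apply, this]
      exact_mod_cast hg0)
  refine ⟨K, hK, fun t ht => ?_⟩
  have h0 : 0 ≤ (t ^ 2 - 1) / (t ^ 2 + 1) := div_nonneg (by nlinarith) (by positivity)
  have hn : ‖(((t ^ 2 - 1) / (t ^ 2 + 1) : ℝ) : ℂ)‖ = (t ^ 2 - 1) / (t ^ 2 + 1) := by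
    rw [Complex.norm_real, Real.norm_of_nonneg h0]
  have h1 := hKb (((t ^ 2 - 1) / (t ^ 2 + 1) : ℝ) : ℂ) (by
    rw [mem_ball_zero_iff, hn, div_lt_one (by positivity)]
    linarith)
  rw [Function.comp_apply, hΦreal t ht, hn] at h1
  refine h1.trans ?_
  gcongr
  have h2 : K / (1 - (t ^ 2 - 1) / (t ^ 2 + 1)) = K * (t ^ 2 + 1) / 2 := by
    have : t ^ 2 + 1 ≠ 0 := by positivity
    field_simp
    ring
  rw [h2]
  have : 0 ≤ K * (t ^ 2 + 1) := by positivity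
  linarith

/-- An entire function of exponential type that is bounded on the left half plane, tends to zero
along the negative real axis and grows subexponentially along the positive real axis vanishes, by
the Phragmén–Lindelöf principle and Liouville's theorem. -/
theorem eq_zero_of_subexponential {P : ℂ → ℂ} {R C τ K : ℝ} (hP : Differentiable ℂ P)
    (hleft : ∀ s : ℂ, s.re ≤ 0 → ‖P s‖ ≤ C)
    (hexp : ∀ s : ℂ, ‖P s‖ ≤ C * Real.exp (τ * ‖s‖)) (hK : 0 < K)
    (hreal : ∀ t : ℝ, 1 ≤ t → ‖P (R + t ^ 3 : ℝ)‖ ≤ K * Real.exp (K * (t ^ 2 + 1)))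
    (hlim : Tendsto (fun x : ℝ => P x) atBot (𝓝 0)) (s : ℂ) : P s = 0 := by
  -- the factor `exp (-ε * z)` beats the subexponential growth on the positive reals
  have hε : ∀ ε : ℝ, 0 < ε → ∀ z : ℂ, 0 ≤ z.re → ‖Complex.exp (-ε * z) * P z‖ ≤ C := by
    intro ε hε z hz
    refine PhragmenLindelof.right_half_plane_of_bounded_on_real
      (f := fun z => Complex.exp (-ε * z) * P z) ?_ ⟨1, by norm_num, τ, ?_⟩ ?_ ?_ hz
    · exact Differentiable.diffContOnCl (by fun_prop)
    · apply Asymptotics.IsBigO.of_bound C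
      filter_upwards [mem_inf_of_right (mem_principal_self _)] with w hw
      rw [norm_mul, Complex.norm_exp, Real.rpow_one, Real.norm_of_nonneg (Real.exp_pos _).le]
      have h1 : (-(ε : ℂ) * w).re ≤ 0 := by
        have hw' : 0 < w.re := hw
        simp only [neg_mul, Complex.neg_re, Complex.mul_re, Complex.ofReal_re, Complex.ofReal_im,
          zero_mul, sub_zero]
        have := mul_pos hε hw'
        linarith
      calc _ ≤ 1 * ‖P w‖ := by gcongr; exact Real.exp_le_one_iff.2 h1
        _ ≤ _ := by rw [one_mul]; exact hexp w
    · refine ⟨K * Real.exp (-(ε * R)), ?_⟩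
      rw [eventually_map]
      filter_upwards [eventually_ge_atTop (R + 1), eventually_ge_atTop (R + (2 * K / ε) ^ 3)]
        with x hx1 hx2
      set t : ℝ := (x - R) ^ (1 / 3 : ℝ) with ht
      have hxR : 1 ≤ x - R := by linarith
      have ht3 : t ^ 3 = x - R := by
        rw [ht, ← Real.rpow_natCast, ← Real.rpow_mul (by linarith)]
        norm_num
      have ht1 : 1 ≤ t := Real.one_le_rpow hxR (by norm_num)
      have ht2 : 2 * K / ε ≤ t := by
        refine le_of_pow_le_pow_left₀ (n := 3) (by norm_num) (by linarith) ?_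
        rw [ht3]; linarith
      have hxt : x = R + t ^ 3 := by rw [ht3]; ring
      have h1 := hreal t ht1
      rw [← hxt] at h1
      rw [norm_mul, Complex.norm_exp]
      have h2 : (-(ε : ℂ) * (x : ℂ)).re = -(ε * x) := by simp
      rw [h2]
      calc Real.exp (-(ε * x)) * ‖P x‖
          ≤ Real.exp (-(ε * x)) * (K * Real.exp (K * (t ^ 2 + 1))) := by gcongr
        _ = K * Real.exp (-(ε * x) + K * (t ^ 2 + 1)) := by rw [Real.exp_add]; ring
        _ ≤ _ := by
          gcongr
          rw [div_le_iff₀ hε] at ht2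
          rw [hxt]
          have h3 : t ^ 2 * (2 * K) ≤ t ^ 2 * (t * ε) :=
            mul_le_mul_of_nonneg_left ht2 (sq_nonneg t)
          have h4 : K * 1 ≤ K * t ^ 2 := by
            gcongr
            nlinarith
          nlinarith
    · intro x
      have h1 : ‖Complex.exp (-(ε : ℂ) * (x * Complex.I))‖ = 1 := by
        rw [Complex.norm_exp]; simp
      rw [norm_mul, h1, one_mul]
      exact hleft _ (by simp)
  have hbound : ∀ z : ℂ, ‖P z‖ ≤ C := by
    intro z
    rcases le_or_gt z.re 0 with hz | hz
    · exact hleft z hz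
    · have hl : Tendsto (fun ε : ℝ => ‖Complex.exp (-ε * z) * P z‖) (𝓝[>] 0) (𝓝 ‖P z‖) := by
        have : ContinuousAt (fun ε : ℝ => ‖Complex.exp (-ε * z) * P z‖) 0 := by fun_prop
        have h2 := this.tendsto
        simp only [Complex.ofReal_zero, neg_zero, zero_mul, Complex.exp_zero, one_mul] at h2
        exact h2.mono_left nhdsWithin_le_nhds
      refine le_of_tendsto hl ?_
      filter_upwards [self_mem_nhdsWithin] with ε h
      exact hε ε h z hz.le
  have hconst : ∀ z, P z = P s := fun z => hP.apply_eq_apply_of_bounded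
    ((isBounded_iff_forall_norm_le.2 ⟨C, by rintro _ ⟨z, rfl⟩; exact hbound z⟩)) z s
  simp only [hconst] at hlim
  exact tendsto_nhds_unique tendsto_const_nhds hlim

end Sector

/-! ### The truncated Laplace transform -/

section TruncLaplace

open Filter Topology

/-- The Laplace transform of the restriction of `ψ` to `(0, τ)`, multiplied by `exp (s * τ)`. This
entire function is bounded on the left half plane. -/
noncomputable def truncLaplace (ψ : ℝ → ℝ) (τ : ℝ) (s : ℂ) : ℂ :=
  ∫ t in Ioc 0 τ, Complex.exp (s * (τ - t)) * (ψ t : ℂ)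

variable {ψ : ℝ → ℝ} {τ : ℝ}

lemma norm_exp_mul_sub_le {s : ℂ} {t : ℝ} (ht : t ∈ Ioc 0 τ) :
    ‖Complex.exp (s * (τ - t))‖ ≤ Real.exp (τ * ‖s‖) := by
  rw [Complex.norm_exp]
  apply Real.exp_le_exp.2
  have h1 : (s * ((τ : ℂ) - t)).re = s.re * (τ - t) := by simp
  rw [h1]
  have h2 := Complex.re_le_norm s
  have h3 := norm_nonneg s
  nlinarith [ht.1, ht.2]

lemma integrable_exp_mul (hψ : IntegrableOn ψ (Ioc 0 τ)) (s : ℂ) :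
    IntegrableOn (fun t : ℝ => Complex.exp (s * (τ - t)) * (ψ t : ℂ)) (Ioc 0 τ) := by
  refine Integrable.bdd_mul (c := Real.exp (τ * ‖s‖)) hψ.ofReal
    (by fun_prop : Continuous _).aestronglyMeasurable ?_
  filter_upwards [ae_restrict_mem measurableSet_Ioc] with t ht
  exact norm_exp_mul_sub_le ht

lemma differentiable_truncLaplace (hψ : IntegrableOn ψ (Ioc 0 τ)) :
    Differentiable ℂ (truncLaplace ψ τ) := by
  intro s
  refine (hasDerivAt_integral_of_dominated_loc_of_deriv_le (s := Metric.ball s 1)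
    (F := fun (s : ℂ) (t : ℝ) => Complex.exp (s * (τ - t)) * (ψ t : ℂ))
    (F' := fun (s : ℂ) (t : ℝ) => Complex.exp (s * (τ - t)) * (τ - t) * (ψ t : ℂ))
    (bound := fun t => Real.exp (τ * (‖s‖ + 1)) * τ * ‖ψ t‖)
    (Metric.ball_mem_nhds s one_pos) ?_ (integrable_exp_mul hψ s) ?_ ?_ ?_ ?_).2.differentiableAt
  · exact Eventually.of_forall fun s => (integrable_exp_mul hψ s).aestronglyMeasurable
  · exact (by fun_prop : Continuous _).aestronglyMeasurable.mul hψ.ofReal.aestronglyMeasurable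
  · filter_upwards [ae_restrict_mem measurableSet_Ioc] with t ht x hx
    have hx' : ‖x‖ ≤ ‖s‖ + 1 := by
      have h1 : ‖x - s‖ < 1 := by simpa [dist_eq_norm] using hx
      calc ‖x‖ = ‖s + (x - s)‖ := by ring_nf
        _ ≤ ‖s‖ + ‖x - s‖ := norm_add_le _ _
        _ ≤ _ := by linarith
    have hτ : 0 ≤ τ := ht.1.le.trans ht.2
    rw [norm_mul, norm_mul, Complex.norm_real]
    have h2 : ‖(τ : ℂ) - t‖ ≤ τ := by
      rw [← Complex.ofReal_sub, Complex.norm_real, Real.norm_of_nonneg (by linarith [ht.2])]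
      linarith [ht.1]
    have h3 : ‖Complex.exp (x * (τ - t))‖ ≤ Real.exp (τ * (‖s‖ + 1)) :=
      (norm_exp_mul_sub_le ht).trans (by gcongr)
    gcongr
  · exact hψ.norm.const_mul _
  · refine Eventually.of_forall fun t x _ => ?_
    have h1 : HasDerivAt (fun x : ℂ => x * ((τ : ℂ) - t)) (τ - t) x := by
      simpa using (hasDerivAt_id x).mul_const ((τ : ℂ) - t)
    exact h1.cexp.mul_const _

lemma norm_truncLaplace_le_exp (hψ : IntegrableOn ψ (Ioc 0 τ)) (s : ℂ) :
    ‖truncLaplace ψ τ s‖ ≤ (∫ t in Ioc 0 τ, ‖ψ t‖) * Real.exp (τ * ‖s‖) := by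
  rw [truncLaplace, mul_comm, ← integral_const_mul]
  refine norm_integral_le_of_norm_le (hψ.norm.const_mul _) ?_
  filter_upwards [ae_restrict_mem measurableSet_Ioc] with t ht
  rw [norm_mul, Complex.norm_real]
  gcongr
  exact norm_exp_mul_sub_le ht

lemma norm_exp_mul_sub_le_one {s : ℂ} (hs : s.re ≤ 0) {t : ℝ} (ht : t ∈ Ioc 0 τ) :
    ‖Complex.exp (s * (τ - t))‖ ≤ 1 := by
  rw [Complex.norm_exp, Real.exp_le_one_iff]
  have h1 : (s * ((τ : ℂ) - t)).re = s.re * (τ - t) := by simp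
  rw [h1]
  nlinarith [ht.2]

lemma norm_truncLaplace_le (hψ : IntegrableOn ψ (Ioc 0 τ)) {s : ℂ} (hs : s.re ≤ 0) :
    ‖truncLaplace ψ τ s‖ ≤ ∫ t in Ioc 0 τ, ‖ψ t‖ := by
  refine norm_integral_le_of_norm_le hψ.norm ?_
  filter_upwards [ae_restrict_mem measurableSet_Ioc] with t ht
  rw [norm_mul, Complex.norm_real]
  exact mul_le_of_le_one_left (norm_nonneg _) (norm_exp_mul_sub_le_one hs ht)

lemma tendsto_truncLaplace_atBot (hψ : IntegrableOn ψ (Ioc 0 τ)) :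
    Tendsto (fun x : ℝ => truncLaplace ψ τ x) atBot (𝓝 0) := by
  have h0 : (0 : ℂ) = ∫ t in Ioc 0 τ, (0 : ℂ) := by simp
  rw [h0]
  refine tendsto_integral_filter_of_dominated_convergence (fun t => ‖ψ t‖) ?_ ?_ hψ.norm ?_
  · exact Eventually.of_forall fun s => (integrable_exp_mul hψ s).aestronglyMeasurable
  · filter_upwards [eventually_le_atBot 0] with x hx
    filter_upwards [ae_restrict_mem measurableSet_Ioc] with t ht
    rw [norm_mul, Complex.norm_real]
    exact mul_le_of_le_one_left (norm_nonneg _) (norm_exp_mul_sub_le_one (by simpa using hx) ht)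
  · have h1 : ∀ᵐ t ∂(volume.restrict (Ioc 0 τ)), t ≠ τ :=
      ae_restrict_of_ae (measure_eq_zero_iff_ae_notMem.1 (measure_singleton τ))
    filter_upwards [ae_restrict_mem measurableSet_Ioc, h1] with t ht htτ
    rw [← zero_mul (ψ t : ℂ)]
    refine Tendsto.mul_const _ ?_
    rw [tendsto_zero_iff_norm_tendsto_zero]
    have h2 : ∀ x : ℝ, ‖Complex.exp ((x : ℂ) * (τ - t))‖ = Real.exp (x * (τ - t)) := by
      intro x
      rw [Complex.norm_exp]
      simp
    simp only [h2]
    refine Real.tendsto_exp_atBot.comp (tendsto_id.atBot_mul_const ?_)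
    exact sub_pos.2 (lt_of_le_of_ne ht.2 htτ)

/-- The values at `2 * π * I * n / τ` are the Fourier coefficients of `ψ` on `(0, τ)`. -/
theorem ae_eq_zero_of_truncLaplace_eq_zero (hτ : 0 < τ)
    (hψ : MemLp ψ 2 (volume.restrict (Ioc 0 τ))) (h : ∀ s, truncLaplace ψ τ s = 0) :
    ∀ᵐ t ∂(volume.restrict (Ioc 0 τ)), ψ t = 0 := by
  have hL2 : MemLp (fun t => (ψ t : ℂ)) 2 (volume.restrict (Ioc 0 τ)) := hψ.ofReal
  have hsum := hasSum_sq_fourierCoeffOn hτ hL2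
  have hcoef : ∀ n, fourierCoeffOn hτ (fun t => (ψ t : ℂ)) n = 0 := by
    intro n
    rw [fourierCoeffOn_eq_integral, intervalIntegral.integral_of_le hτ.le]
    have h1 := h (2 * Real.pi * Complex.I * n / τ)
    rw [truncLaplace] at h1
    have h2 : ∀ t : ℝ, (fourier (-n) (t : AddCircle (τ - 0)) : ℂ) • (ψ t : ℂ)
        = Complex.exp (2 * Real.pi * Complex.I * n / τ * (τ - t)) * (ψ t : ℂ) := by
      intro t
      have hτC : (τ : ℂ) ≠ 0 := by exact_mod_cast hτ.ne'
      rw [fourier_coe_apply, smul_eq_mul]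
      congr 1
      rw [Complex.exp_eq_exp_iff_exists_int]
      refine ⟨-n, ?_⟩
      push_cast
      field_simp
      ring
    simp only [h2, h1, smul_zero]
  simp only [hcoef, norm_zero, ne_eq, OfNat.ofNat_ne_zero, not_false_eq_true, zero_pow] at hsum
  have h3 := hsum.unique hasSum_zero
  rw [intervalIntegral.integral_of_le hτ.le, smul_eq_zero] at h3
  have h4 := h3.resolve_left (inv_ne_zero (by linarith))
  rw [integral_eq_zero_iff_of_nonneg (fun t => by positivity) (hL2.integrable_norm_pow (by simp))]
    at h4
  filter_upwards [h4] with t ht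
  simpa using ht

/-- If the truncated Laplace transform of `ψ` is bounded after multiplication with a bounded
holomorphic function on a sector, either that function or `ψ` vanishes. -/
theorem ae_eq_zero_of_bounded_quotient (hτ : 0 < τ) (hψ : MemLp ψ 2 (volume.restrict (Ioc 0 τ)))
    {g : ℂ → ℂ} {R C : ℝ} (hR : 0 < R)
    (hg : ∀ s : ℂ, -(3 / 4) * ‖s‖ < s.re → R / 3 < ‖s‖ →
      DifferentiableAt ℂ g s ∧ ‖g s‖ ≤ C ∧ ‖truncLaplace ψ τ s * g s‖ ≤ C)
    (hg0 : g (R + 1 : ℝ) ≠ 0) : ∀ᵐ t ∂(volume.restrict (Ioc 0 τ)), ψ t = 0 := by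
  have hψ1 : IntegrableOn ψ (Ioc 0 τ) := hψ.integrable (by norm_num)
  obtain ⟨K, hK, hKb⟩ :=
    norm_le_exp_of_bounded_quotient_sector hR (differentiable_truncLaplace hψ1) hg hg0
  exact ae_eq_zero_of_truncLaplace_eq_zero hτ hψ
    (eq_zero_of_subexponential (differentiable_truncLaplace hψ1)
      (fun s hs => norm_truncLaplace_le hψ1 hs) (norm_truncLaplace_le_exp hψ1) hK hKb
      (tendsto_truncLaplace_atBot hψ1))

end TruncLaplace

/-! ### The damped oscillator of a single mode -/

section Oscillator

open Filter Topology

/-- `z` is the solution of `z'' + b * l * z' + c ^ 2 * l * z = ψ`, `z 0 = z' 0 = 0`, and `w` is its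
derivative. -/
structure IsModeSolution (b c l : ℝ) (ψ z w : ℝ → ℝ) : Prop where
  hasDerivAt_fst : ∀ t, HasDerivAt z (w t) t
  hasDerivAt_snd : ∀ t, HasDerivAt w (ψ t - b * l * w t - c ^ 2 * l * z t) t
  fst_zero : z 0 = 0
  snd_zero : w 0 = 0

/-- Variation of constants for a damped oscillator with continuous forcing. -/
lemma exists_oscillator (B C : ℝ) {F : ℝ → ℝ} (hF : Continuous F) :
    ∃ z w : ℝ → ℝ, (∀ t, HasDerivAt z (w t) t) ∧ (∀ t, HasDerivAt w (F t - B * w t - C * z t) t) ∧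
      z 0 = 0 ∧ w 0 = 0 := by
  set M : ℝ × ℝ →L[ℝ] ℝ × ℝ := (ContinuousLinearMap.snd ℝ ℝ ℝ).prod
    (-(B • ContinuousLinearMap.snd ℝ ℝ ℝ) - C • ContinuousLinearMap.fst ℝ ℝ ℝ) with hM
  have hexp : ∀ t : ℝ, HasDerivAt (fun s : ℝ => NormedSpace.exp (s • M))
      (M * NormedSpace.exp (t • M)) t := fun t => hasDerivAt_exp_smul_const' M t
  have hcont : Continuous fun s : ℝ => NormedSpace.exp (s • M) :=
    continuous_iff_continuousAt.2 fun t => (hexp t).continuousAt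
  have hg : Continuous fun s : ℝ => NormedSpace.exp ((-s) • M) ((0, F s) : ℝ × ℝ) :=
    (hcont.comp continuous_neg).clm_apply (by fun_prop)
  set I : ℝ → ℝ × ℝ := fun t => ∫ s in (0 : ℝ)..t, NormedSpace.exp ((-s) • M) ((0, F s) : ℝ × ℝ)
    with hI
  have hId : ∀ t, HasDerivAt I (NormedSpace.exp ((-t) • M) ((0, F t) : ℝ × ℝ)) t := fun t =>
    (hg.integral_hasStrictDerivAt 0 t).hasDerivAt
  set Y : ℝ → ℝ × ℝ := fun t => NormedSpace.exp (t • M) (I t) with hY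
  have hYd : ∀ t, HasDerivAt Y (M (Y t) + (0, F t)) t := by
    intro t
    have h1 := (hexp t).clm_apply (hId t)
    have h2 : NormedSpace.exp (t • M) (NormedSpace.exp ((-t) • M) ((0, F t) : ℝ × ℝ))
        = (0, F t) := by
      let : NormedAlgebra ℚ (ℝ × ℝ →L[ℝ] ℝ × ℝ) := NormedAlgebra.restrictScalars ℚ ℝ _
      rw [← mul_apply_eq_comp, ← NormedSpace.exp_add_of_commute
        (((Commute.refl M).smul_left t).smul_right (-t)), ← add_smul]
      simp
    rw [h2] at h1
    exact h1
  have hY0 : Y 0 = 0 := by simp [hY, hI]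
  refine ⟨fun t => (Y t).1, fun t => (Y t).2, fun t => ?_, fun t => ?_, ?_, ?_⟩
  · have := (hYd t).hasFDerivAt.fst.hasDerivAt
    simpa [hM] using this
  · have := (hYd t).hasFDerivAt.snd.hasDerivAt
    refine this.congr_deriv ?_
    simp [hM]
    ring
  · simp [hY0]
  · simp [hY0]

/-- The forcing need not be continuous: the equation is integrated once, so that the forcing becomes
the continuous function `θ`. -/
theorem exists_isModeSolution (b c l : ℝ) {θ ψ : ℝ → ℝ} (hθ : ∀ t, HasDerivAt θ (ψ t) t) :
    ∃ z w : ℝ → ℝ, IsModeSolution b c l ψ z w := by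
  have hc : Continuous fun t => θ t - θ 0 :=
    (continuous_iff_continuousAt.2 fun t => (hθ t).continuousAt).sub continuous_const
  obtain ⟨Z, z, hZ, hz, hZ0, hz0⟩ := exists_oscillator (b * l) (c ^ 2 * l) hc
  refine ⟨z, fun t => θ t - θ 0 - b * l * z t - c ^ 2 * l * Z t, ⟨hz, fun t => ?_, hz0, ?_⟩⟩
  · exact (((hθ t).sub_const _).sub ((hz t).const_mul _)).sub ((hZ t).const_mul _)
  · simp [hZ0, hz0]

lemma le_integral_of_hasDerivAt_le {g g' φ : ℝ → ℝ} {τ t : ℝ} (ht : t ∈ Icc 0 τ)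
    (hg : ∀ t, HasDerivAt g (g' t) t) (h0 : g 0 = 0) (hφ : IntegrableOn φ (Icc 0 τ))
    (hle : ∀ t ∈ Ioo 0 τ, g' t ≤ φ t) (hφ0 : ∀ t, 0 ≤ φ t) : g t ≤ ∫ s in Ioc 0 τ, φ s := by
  have h1 := intervalIntegral.sub_le_integral_of_hasDeriv_right_of_le ht.1
    (fun x _ => (hg x).continuousAt.continuousWithinAt) (fun x _ => (hg x).hasDerivWithinAt)
    (hφ.mono_set (Icc_subset_Icc_right ht.2)) (fun x hx => hle x ⟨hx.1, hx.2.trans_le ht.2⟩)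
  rw [h0, sub_zero, intervalIntegral.integral_of_le ht.1] at h1
  refine h1.trans (setIntegral_mono_set (hφ.mono_set Ioc_subset_Icc_self)
    (Eventually.of_forall hφ0) (Ioc_subset_Ioc_right ht.2).eventuallyLE)

/-- Energy estimates for a single mode, uniform in the eigenvalue `l`. They express maximal
regularity of the strongly damped wave equation. -/
theorem exists_mode_bound {b c : ℝ} (hb : 0 < b) (hc : 0 < c) {ψ : ℝ → ℝ} {τ : ℝ} (hτ : 0 ≤ τ)
    (hψ : MemLp ψ 2 (volume.restrict (Ioc 0 τ))) :
    ∃ K : ℝ, 0 ≤ K ∧ ∀ l : ℝ, 0 < l → ∀ z w : ℝ → ℝ, IsModeSolution b c l ψ z w →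
      (∀ t ∈ Icc 0 τ, w t ^ 2 ≤ K ∧ ((1 + l) * z t) ^ 2 ≤ K) ∧
      ∫ t in Ioc 0 τ, (l * w t) ^ 2 ≤ K ∧
      ∫ t in Ioc 0 τ, (ψ t - b * l * w t - c ^ 2 * l * z t) ^ 2 ≤ K := by
  have hψ2 : IntegrableOn (fun t => ψ t ^ 2) (Ioc 0 τ) := hψ.integrable_sq
  have hψ2' : IntegrableOn (fun t => ψ t ^ 2) (Icc 0 τ) :=
    (integrableOn_Icc_iff_integrableOn_Ioc).2 hψ2
  set J := ∫ t in Ioc 0 τ, ψ t ^ 2 with hJ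
  have hJ0 : 0 ≤ J := integral_nonneg fun t => sq_nonneg _
  set W := Real.exp τ * J with hW
  have hW0 : 0 ≤ W := by positivity
  set L := J / b / c ^ 2 with hL
  have hL0 : 0 ≤ L := by positivity
  refine ⟨W + (2 * (Real.exp τ * (τ * W)) + 2 * L) + J / b / b +
    (3 * J + 3 * b ^ 2 * (J / b / b) + 3 * c ^ 4 * (τ * L)), by positivity, ?_⟩
  intro l hl z w h
  have hzc : Continuous z := continuous_iff_continuousAt.2 fun t => (h.1 t).continuousAt
  have hwc : Continuous w := continuous_iff_continuousAt.2 fun t => (h.2 t).continuousAt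
  have hexp : ∀ t, HasDerivAt (fun t : ℝ => Real.exp (-t)) (-Real.exp (-t)) t := fun t => by
    simpa using (hasDerivAt_neg t).exp
  -- the energy `w ^ 2 + c ^ 2 * l * z ^ 2`; the weight `exp (-t)` absorbs the term `w * ψ`
  -- uniformly in `l`
  have h1 : ∀ t ∈ Icc 0 τ, w t ^ 2 ≤ W := by
    intro t ht
    have hd : ∀ t, HasDerivAt (fun t => Real.exp (-t) * (w t ^ 2 + c ^ 2 * l * z t ^ 2))
        (Real.exp (-t) * (2 * w t * ψ t - 2 * b * l * w t ^ 2
          - (w t ^ 2 + c ^ 2 * l * z t ^ 2))) t := by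
      intro t
      refine HasDerivAt.congr_deriv ((hexp t).mul
        (((h.2 t).pow 2).add (((h.1 t).pow 2).const_mul (c ^ 2 * l)))) ?_
      simp
      ring
    have h2 := le_integral_of_hasDerivAt_le ht hd (by simp [h.3, h.4]) hψ2' (fun t ht => by
      have h3 : Real.exp (-t) ≤ 1 := Real.exp_le_one_iff.2 (by linarith [ht.1])
      have h5 : 2 * w t * ψ t - 2 * b * l * w t ^ 2 - (w t ^ 2 + c ^ 2 * l * z t ^ 2)
          ≤ ψ t ^ 2 := by
        have : 0 ≤ b * l * w t ^ 2 := by positivity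
        have : 0 ≤ c ^ 2 * l * z t ^ 2 := by positivity
        nlinarith [sq_nonneg (w t - ψ t)]
      calc _ ≤ Real.exp (-t) * ψ t ^ 2 := by gcongr
        _ ≤ 1 * ψ t ^ 2 := by gcongr
        _ = _ := one_mul _) (fun t => sq_nonneg _)
    rw [Real.exp_neg, inv_mul_le_iff₀ (Real.exp_pos _)] at h2
    have h3 : 0 ≤ c ^ 2 * l * z t ^ 2 := by positivity
    calc w t ^ 2 ≤ Real.exp t * J := by linarith
      _ ≤ W := by rw [hW]; gcongr; exact ht.2
  have h2 : ∀ t ∈ Icc 0 τ, z t ^ 2 ≤ Real.exp τ * (τ * W) := by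
    intro t ht
    have hd : ∀ t, HasDerivAt (fun t => Real.exp (-t) * z t ^ 2)
        (Real.exp (-t) * (2 * z t * w t - z t ^ 2)) t := by
      intro t
      refine HasDerivAt.congr_deriv ((hexp t).mul ((h.1 t).pow 2)) ?_
      simp
      ring
    have h2 := le_integral_of_hasDerivAt_le ht hd (by simp [h.3]) (φ := fun _ => W)
      (by simp) (fun t ht => by
      have h3 : Real.exp (-t) ≤ 1 := Real.exp_le_one_iff.2 (by linarith [ht.1])
      have h5 : 2 * z t * w t - z t ^ 2 ≤ W := by
        have := h1 t ⟨ht.1.le, ht.2.le⟩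
        nlinarith [sq_nonneg (w t - z t)]
      calc _ ≤ Real.exp (-t) * W := by gcongr
        _ ≤ 1 * W := by gcongr
        _ = _ := one_mul _) (fun t => hW0)
    rw [Real.exp_neg, inv_mul_le_iff₀ (Real.exp_pos _)] at h2
    simp only [integral_const, MeasurableSet.univ, measureReal_restrict_apply, univ_inter,
      Real.volume_real_Ioc_of_le hτ, sub_zero, smul_eq_mul] at h2
    exact h2.trans (by gcongr; exact ht.2)
  -- multiplying the equation by `l * w` gains a factor `l`: the energy
  -- `l * w ^ 2 + c ^ 2 * l ^ 2 * z ^ 2` together with its dissipation is bounded by the source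
  have h3 : ∀ t ∈ Icc 0 τ, l * w t ^ 2 + c ^ 2 * l ^ 2 * z t ^ 2
      + b * ∫ s in (0 : ℝ)..t, (l * w s) ^ 2 ≤ J / b := by
    intro t ht
    have hcw : Continuous fun s => (l * w s) ^ 2 := by fun_prop
    have hd : ∀ t, HasDerivAt (fun t => l * w t ^ 2 + c ^ 2 * l ^ 2 * z t ^ 2
        + b * ∫ s in (0 : ℝ)..t, (l * w s) ^ 2)
        (2 * l * w t * ψ t - b * (l * w t) ^ 2) t := by
      intro t
      refine HasDerivAt.congr_deriv
        (((((h.2 t).pow 2).const_mul l).add (((h.1 t).pow 2).const_mul (c ^ 2 * l ^ 2))).add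
        ((hcw.integral_hasStrictDerivAt 0 t).hasDerivAt.const_mul b)) ?_
      simp
      ring
    have h4 := le_integral_of_hasDerivAt_le ht hd (by simp [h.3, h.4])
      (φ := fun t => ψ t ^ 2 / b) (hψ2'.div_const b) (fun t ht => by
      rw [le_div_iff₀ hb]
      nlinarith [sq_nonneg (b * (l * w t) - ψ t)]) (fun t => by positivity)
    rwa [integral_div] at h4
  have h4 : ∀ t ∈ Icc 0 τ, (l * z t) ^ 2 ≤ L := by
    intro t ht
    have h5 := h3 t ht
    have h6 : 0 ≤ ∫ s in (0 : ℝ)..t, (l * w s) ^ 2 :=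
      intervalIntegral.integral_nonneg ht.1 fun s _ => sq_nonneg _
    have h7 : 0 ≤ l * w t ^ 2 := by positivity
    rw [hL, le_div_iff₀ (by positivity)]
    nlinarith
  have h5 : ∫ t in Ioc 0 τ, (l * w t) ^ 2 ≤ J / b / b := by
    have h6 := h3 τ ⟨hτ, le_rfl⟩
    rw [intervalIntegral.integral_of_le hτ] at h6
    have h7 : 0 ≤ l * w τ ^ 2 := by positivity
    have h8 : 0 ≤ c ^ 2 * l ^ 2 * z τ ^ 2 := by positivity
    rw [le_div_iff₀ hb]
    linarith
  have p1 : 0 ≤ Real.exp τ * (τ * W) := by positivity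
  have p2 : 0 ≤ J / b / b := by positivity
  have p3 : 0 ≤ 3 * b ^ 2 * (J / b / b) := by positivity
  have p4 : 0 ≤ 3 * c ^ 4 * (τ * L) := by positivity
  refine ⟨fun t ht => ⟨?_, ?_⟩, ?_, ?_⟩
  · linarith [h1 t ht]
  · have := h2 t ht
    have := h4 t ht
    nlinarith [sq_nonneg (z t - l * z t)]
  · linarith
  · have hle : ∫ t in Ioc 0 τ, (ψ t - b * l * w t - c ^ 2 * l * z t) ^ 2
        ≤ ∫ t in Ioc 0 τ, (3 * ψ t ^ 2 + 3 * b ^ 2 * (l * w t) ^ 2 + 3 * c ^ 4 * L) := by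
      have hi1 : IntegrableOn (fun t => 3 * b ^ 2 * (l * w t) ^ 2) (Ioc 0 τ) :=
        (by fun_prop : Continuous fun t => 3 * b ^ 2 * (l * w t) ^ 2).integrableOn_Ioc
      refine integral_mono_of_nonneg (Eventually.of_forall fun t => sq_nonneg _)
        (((hψ2.const_mul 3).add hi1).add (integrable_const _)) ?_
      filter_upwards [ae_restrict_mem measurableSet_Ioc] with t ht
      have h6 := h4 t ⟨ht.1.le, ht.2⟩
      have h7 : c ^ 4 * (l * z t) ^ 2 ≤ c ^ 4 * L := by gcongr
      nlinarith [sq_nonneg (ψ t + b * l * w t), sq_nonneg (ψ t + c ^ 2 * l * z t),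
        sq_nonneg (b * l * w t - c ^ 2 * l * z t)]
    have heq : ∫ t in Ioc 0 τ, (3 * ψ t ^ 2 + 3 * b ^ 2 * (l * w t) ^ 2 + 3 * c ^ 4 * L)
        = 3 * J + 3 * b ^ 2 * (∫ t in Ioc 0 τ, (l * w t) ^ 2) + 3 * c ^ 4 * (τ * L) := by
      have hi1 : IntegrableOn (fun t => 3 * b ^ 2 * (l * w t) ^ 2) (Ioc 0 τ) :=
        (by fun_prop : Continuous fun t => 3 * b ^ 2 * (l * w t) ^ 2).integrableOn_Ioc
      have hi2 : IntegrableOn (fun t => 3 * ψ t ^ 2 + 3 * b ^ 2 * (l * w t) ^ 2) (Ioc 0 τ) :=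
        (hψ2.const_mul 3).add hi1
      rw [integral_add hi2 (integrable_const _), integral_add (hψ2.const_mul 3) hi1,
        integral_const_mul, integral_const_mul]
      simp only [integral_const, MeasurableSet.univ, measureReal_restrict_apply, univ_inter,
        Real.volume_real_Ioc_of_le hτ, sub_zero, smul_eq_mul]
      ring
    rw [heq] at hle
    have h6 : 3 * b ^ 2 * (∫ t in Ioc 0 τ, (l * w t) ^ 2) ≤ 3 * b ^ 2 * (J / b / b) := by gcongr
    linarith

end Oscillator

/-! ### Spectral uniqueness for the observed series -/

section Spectral

open Filter Topology

/-- The characteristic polynomial of the mode with eigenvalue `l`. -/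
noncomputable def charPoly (b c l : ℝ) (s : ℂ) : ℂ := s ^ 2 + b * l * s + c ^ 2 * l

variable {b c : ℝ}

/-- A lower bound uniform in `l`: in the sector `s * (s + b * l)` is at least
`‖s‖ * (‖s‖ + b * l) / 3` in modulus, and for large `s` the term `c ^ 2 * l` is a quarter of
`b * l * ‖s‖` at most. -/
lemma norm_charPoly_ge (hb : 0 < b) {l : ℝ} (hl : 0 < l) {s : ℂ}
    (hs : -(3 / 4) * ‖s‖ ≤ s.re) (hsc : 4 * c ^ 2 / b ≤ ‖s‖) :
    ‖s‖ * (‖s‖ + b * l) / 12 ≤ ‖charPoly b c l s‖ := by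
  have h1 := norm_add_ge_of_sector hs (mul_pos hb hl).le
  have h2 : s * (s + ((b * l : ℝ) : ℂ)) = charPoly b c l s - ((c ^ 2 * l : ℝ) : ℂ) := by
    rw [charPoly]; push_cast; ring
  have h3 : ‖s‖ * ‖s + ((b * l : ℝ) : ℂ)‖ ≤ ‖charPoly b c l s‖ + c ^ 2 * l := by
    rw [← norm_mul, h2]
    refine (norm_sub_le _ _).trans (le_of_eq ?_)
    rw [Complex.norm_real, Real.norm_of_nonneg (by positivity)]
  have h4 := norm_nonneg s
  rw [div_le_iff₀ hb] at hsc
  have h5 : 4 * c ^ 2 * l ≤ ‖s‖ * b * l := by gcongr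
  have h6 := mul_le_mul_of_nonneg_left h1 h4
  nlinarith [sq_nonneg ‖s‖]

lemma one_add_div_norm_charPoly_le (hb : 0 < b) {l : ℝ} (hl : 0 < l) {s : ℂ}
    (hs : -(3 / 4) * ‖s‖ ≤ s.re) (hsc : 4 * c ^ 2 / b ≤ ‖s‖) (hs1 : 1 ≤ ‖s‖) :
    (1 + l) / ‖charPoly b c l s‖ ≤ 12 * (1 + 1 / b) := by
  have h1 := norm_charPoly_ge hb hl hs hsc
  have hbl := mul_pos hb hl
  have h2 : (1 + b * l) / 12 ≤ ‖charPoly b c l s‖ := by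
    refine le_trans ?_ h1
    gcongr
    nlinarith
  rw [div_le_iff₀ (lt_of_lt_of_le (by positivity) h2)]
  have h3 : 1 + l ≤ (1 + 1 / b) * (1 + b * l) := by
    have : (1 + 1 / b) * (1 + b * l) = 1 + b * l + 1 / b + l := by field_simp; ring
    have : 0 < 1 / b := by positivity
    linarith
  calc 1 + l ≤ (1 + 1 / b) * (1 + b * l) := h3
    _ = 12 * (1 + 1 / b) * ((1 + b * l) / 12) := by ring
    _ ≤ _ := by gcongr

/-- Integration by parts turns the oscillator equation into an algebraic one, up to the values at
the final time. -/
lemma IsModeSolution.charPoly_mul_integral {l τ : ℝ} {ψ z w : ℝ → ℝ}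
    (h : IsModeSolution b c l ψ z w) (hτ : 0 ≤ τ) (hψ : IntegrableOn ψ (Ioc 0 τ)) (s : ℂ) :
    charPoly b c l s * ∫ t in Ioc 0 τ, Complex.exp (s * (τ - t)) * (z t : ℂ)
      = truncLaplace ψ τ s - (w τ + (s + b * l) * z τ) := by
  have hz : Continuous z := continuous_iff_continuousAt.2 fun t => (h.1 t).continuousAt
  have hi := integrable_exp_mul hψ s
  have hi2 : IntegrableOn (fun t : ℝ => charPoly b c l s * (Complex.exp (s * (τ - t)) * (z t : ℂ)))
      (Ioc 0 τ) := (by fun_prop : Continuous fun t : ℝ =>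
        charPoly b c l s * (Complex.exp (s * (τ - t)) * (z t : ℂ))).integrableOn_Ioc
  have hd : ∀ t : ℝ, HasDerivAt
      (fun t : ℝ => Complex.exp (s * (τ - t)) * ((w t : ℂ) + (s + b * l) * z t))
      (Complex.exp (s * (τ - t)) * (ψ t : ℂ)
        - charPoly b c l s * (Complex.exp (s * (τ - t)) * (z t : ℂ))) t := by
    intro t
    have h1 : HasDerivAt (fun t : ℝ => s * ((τ : ℂ) - t)) (-s) t := by
      simpa using ((Complex.ofRealCLM.hasDerivAt (x := t)).const_sub (τ : ℂ)).const_mul s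
    refine (h1.cexp.mul ((h.2 t).ofReal_comp.add
      ((h.1 t).ofReal_comp.const_mul (s + b * l)))).congr_deriv ?_
    simp only [Pi.add_apply, charPoly]
    push_cast
    ring
  have h2 := intervalIntegral.integral_eq_sub_of_hasDerivAt (a := 0) (b := τ) (fun t _ => hd t)
    ((intervalIntegrable_iff_integrableOn_Ioc_of_le hτ).2 (hi.sub hi2))
  rw [intervalIntegral.integral_of_le hτ, integral_sub hi hi2, integral_const_mul] at h2
  simp only [h.3, h.4, sub_self, mul_zero, Complex.exp_zero, one_mul, Complex.ofReal_zero,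
    add_zero, sub_zero] at h2
  rw [truncLaplace, ← h2]
  ring

/-- The transfer function of the observed series. -/
noncomputable def transfer (b c : ℝ) (lam k : ℕ → ℝ) (s : ℂ) : ℂ :=
  ∑' j, (k j : ℂ) * (1 + lam j) / charPoly b c (lam j) s

variable {lam k : ℕ → ℝ} {ψ : ℝ → ℝ} {τ : ℝ} {z w : ℕ → ℝ → ℝ}

lemma norm_transfer_term_le (hb : 0 < b) (hl : ∀ j, 0 < lam j) {s : ℂ}
    (hs : -(3 / 4) * ‖s‖ ≤ s.re) (hsc : 4 * c ^ 2 / b ≤ ‖s‖) (hs1 : 1 ≤ ‖s‖) (j : ℕ) :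
    ‖(k j : ℂ) * (1 + lam j) / charPoly b c (lam j) s‖ ≤ |k j| * (12 * (1 + 1 / b)) := by
  have h1 := one_add_div_norm_charPoly_le hb (hl j) hs hsc hs1
  have h2 : ‖(1 : ℂ) + lam j‖ = 1 + lam j := by
    have := hl j
    rw [← Complex.ofReal_one, ← Complex.ofReal_add, Complex.norm_real,
      Real.norm_of_nonneg (by linarith)]
  rw [norm_div, norm_mul, h2, Complex.norm_real, mul_div_assoc]
  exact mul_le_mul_of_nonneg_left h1 (abs_nonneg _)

/-- If the observation vanishes on `(0, τ)`, the product of the truncated Laplace transform of the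
source and the transfer function is a series of final values, hence bounded on a sector. -/
lemma norm_truncLaplace_mul_transfer_le (hb : 0 < b) (hl : ∀ j, 0 < lam j)
    (hk : Summable fun j => |k j|) (hτ : 0 < τ) (hψ : IntegrableOn ψ (Ioc 0 τ))
    (hz : ∀ j, IsModeSolution b c (lam j) ψ (z j) (w j)) {κ : ℝ}
    (hκ : ∀ j, ∀ t ∈ Icc 0 τ, |w j t| ≤ κ ∧ |(1 + lam j) * z j t| ≤ κ)
    (h0 : ∀ t ∈ Ioo 0 τ, ∑' j, k j * ((1 + lam j) * z j t) = 0) {s : ℂ}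
    (hs : -(3 / 4) * ‖s‖ ≤ s.re) (hsc : 4 * c ^ 2 / b ≤ ‖s‖) (hs1 : 1 ≤ ‖s‖) :
    ‖truncLaplace ψ τ s * transfer b c lam k s‖
      ≤ (∑' j, |k j|) * (12 * (1 + 1 / b) * κ + 12 * κ) := by
  have hκ0 : 0 ≤ κ := (abs_nonneg _).trans (hκ 0 0 ⟨le_rfl, hτ.le⟩).1
  have hDne : ∀ j, charPoly b c (lam j) s ≠ 0 := by
    intro j h
    have h1 := norm_charPoly_ge hb (hl j) hs hsc
    rw [h, norm_zero] at h1
    have := mul_pos hb (hl j)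
    have : 0 < ‖s‖ * (‖s‖ + b * lam j) / 12 := by positivity
    linarith
  have hzc : ∀ j, Continuous (z j) := fun j =>
    continuous_iff_continuousAt.2 fun t => ((hz j).1 t).continuousAt
  -- the weighted sum of the Laplace transforms of the modes vanishes
  have hZ : HasSum (fun j => (k j : ℂ) * (1 + lam j) *
      ∫ t in Ioc 0 τ, Complex.exp (s * (τ - t)) * (z j t : ℂ)) 0 := by
    have h1 : HasSum (fun j => ∫ t in Ioc 0 τ, Complex.exp (s * (τ - t)) *
        ((k j * ((1 + lam j) * z j t) : ℝ) : ℂ)) (∫ t in Ioc 0 τ, (0 : ℂ)) := by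
      refine hasSum_integral_of_dominated_convergence
        (fun j _ => Real.exp (τ * ‖s‖) * (|k j| * κ)) ?_ ?_ ?_ ?_ ?_
      · intro j
        have := hzc j
        exact (by fun_prop : Continuous _).aestronglyMeasurable
      · intro j
        filter_upwards [ae_restrict_mem measurableSet_Ioc] with t ht
        rw [norm_mul, Complex.norm_real, Real.norm_eq_abs, abs_mul]
        gcongr
        · exact norm_exp_mul_sub_le ht
        · exact (hκ j t ⟨ht.1.le, ht.2⟩).2
      · exact Eventually.of_forall fun _ => (hk.mul_right κ).mul_left _
      · exact integrable_const _
      · have h1 : ∀ᵐ t ∂(volume.restrict (Ioc 0 τ)), t ≠ τ :=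
          ae_restrict_of_ae (measure_eq_zero_iff_ae_notMem.1 (measure_singleton τ))
        filter_upwards [ae_restrict_mem measurableSet_Ioc, h1] with t ht htτ
        have h2 : HasSum (fun j => k j * ((1 + lam j) * z j t)) 0 := by
          rw [← h0 t ⟨ht.1, lt_of_le_of_ne ht.2 htτ⟩]
          refine Summable.hasSum (Summable.of_norm_bounded (hk.mul_right κ) fun j => ?_)
          rw [Real.norm_eq_abs, abs_mul]
          gcongr
          exact (hκ j t ⟨ht.1.le, ht.2⟩).2
        simpa using (Complex.hasSum_ofReal.2 h2).mul_left (Complex.exp (s * (τ - t)))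
    simp only [integral_zero] at h1
    refine h1.congr_fun fun j => ?_
    rw [← integral_const_mul]
    refine integral_congr_ae (Eventually.of_forall fun t => ?_)
    push_cast
    ring
  set B : ℕ → ℂ := fun j => (k j : ℂ) * (1 + lam j) / charPoly b c (lam j) s *
    (w j τ + (s + b * lam j) * z j τ) with hB
  have hg : HasSum (fun j => (k j : ℂ) * (1 + lam j) / charPoly b c (lam j) s)
      (transfer b c lam k s) :=
    (Summable.of_norm_bounded (hk.mul_right _) (norm_transfer_term_le hb hl hs hsc hs1)).hasSum
  have hBsum : HasSum B (truncLaplace ψ τ s * transfer b c lam k s) := by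
    have h1 := (hg.mul_left (truncLaplace ψ τ s)).sub hZ
    rw [sub_zero] at h1
    refine h1.congr_fun fun j => ?_
    have h2 := (hz j).charPoly_mul_integral hτ.le hψ s
    have h3 : truncLaplace ψ τ s = charPoly b c (lam j) s *
        (∫ t in Ioc 0 τ, Complex.exp (s * (τ - t)) * (z j t : ℂ))
        + (w j τ + (s + b * lam j) * z j τ) := by rw [h2]; ring
    rw [h3, hB]
    have := hDne j
    field_simp
    ring
  have hBle : ∀ j, ‖B j‖ ≤ |k j| * (12 * (1 + 1 / b) * κ + 12 * κ) := by
    intro j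
    obtain ⟨hw, hzj⟩ := hκ j τ ⟨hτ.le, le_rfl⟩
    have hlj := hl j
    have hblj := mul_pos hb hlj
    have e1 : B j = (k j : ℂ) * (1 + lam j) / charPoly b c (lam j) s * w j τ
        + (k j : ℂ) * ((((1 + lam j) * z j τ : ℝ) : ℂ) *
          ((s + b * lam j) / charPoly b c (lam j) s)) := by
      rw [hB]; push_cast; ring
    have e2 : ‖(s + b * lam j) / charPoly b c (lam j) s‖ ≤ 12 := by
      have h1 := norm_charPoly_ge hb hlj hs hsc
      have h2 : ‖s + b * lam j‖ ≤ ‖s‖ + b * lam j := by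
        refine (norm_add_le _ _).trans (le_of_eq ?_)
        rw [← Complex.ofReal_mul, Complex.norm_real, Real.norm_of_nonneg hblj.le]
      have h3 : 0 < ‖s‖ + b * lam j := by positivity
      have h4 : (‖s‖ + b * lam j) / 12 ≤ ‖charPoly b c (lam j) s‖ := by
        refine le_trans ?_ h1
        gcongr
        nlinarith
      rw [norm_div, div_le_iff₀ (lt_of_lt_of_le (by positivity) h4)]
      linarith
    rw [e1]
    refine (norm_add_le _ _).trans ?_
    rw [mul_add |k j|]
    apply add_le_add
    · rw [norm_mul, Complex.norm_real, Real.norm_eq_abs, ← mul_assoc]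
      gcongr
      exact norm_transfer_term_le hb hl hs hsc hs1 j
    · rw [norm_mul, Complex.norm_real, Real.norm_eq_abs, norm_mul, Complex.norm_real,
        Real.norm_eq_abs, mul_comm 12 κ]
      gcongr
  rw [← hBsum.tsum_eq, ← tsum_mul_right]
  exact tsum_of_norm_bounded (hk.mul_right _).hasSum hBle

/-- A nonzero value of the transfer function at a large real point would make the truncated Laplace
transform a bounded quotient on a sector, against the assumption that the source is nonzero. -/
lemma transfer_eq_zero (hb : 0 < b) (hl : ∀ j, 0 < lam j)
    (hk : Summable fun j => |k j|) (hτ : 0 < τ) (hψ : MemLp ψ 2 (volume.restrict (Ioc 0 τ)))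
    (hψ0 : ¬ ∀ᵐ t ∂(volume.restrict (Ioc 0 τ)), ψ t = 0)
    (hz : ∀ j, IsModeSolution b c (lam j) ψ (z j) (w j)) {κ : ℝ}
    (hκ : ∀ j, ∀ t ∈ Icc 0 τ, |w j t| ≤ κ ∧ |(1 + lam j) * z j t| ≤ κ)
    (h0 : ∀ t ∈ Ioo 0 τ, ∑' j, k j * ((1 + lam j) * z j t) = 0) {x : ℝ}
    (hx : 3 * max 1 (4 * c ^ 2 / b) + 1 ≤ x) : transfer b c lam k (x : ℂ) = 0 := by
  have hψ1 : IntegrableOn ψ (Ioc 0 τ) := hψ.integrable (by norm_num)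
  by_contra hne
  refine hψ0 (ae_eq_zero_of_bounded_quotient hτ hψ (R := x - 1) (g := transfer b c lam k)
    (C := max ((∑' j, |k j|) * (12 * (1 + 1 / b) * κ + 12 * κ))
      (∑' j, |k j| * (12 * (1 + 1 / b)))) ?_ ?_ ?_)
  · have := le_max_left 1 (4 * c ^ 2 / b)
    linarith
  · intro s hs hsR
    have hsm : max 1 (4 * c ^ 2 / b) < ‖s‖ := by linarith
    obtain ⟨hs1, hsc⟩ := max_lt_iff.1 hsm
    refine ⟨?_, ?_, ?_⟩
    · set U : Set ℂ := {s | -(3 / 4) * ‖s‖ < s.re} ∩ {s | max 1 (4 * c ^ 2 / b) < ‖s‖} with hU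
      have hUo : IsOpen U :=
        (isOpen_lt (by fun_prop) (by fun_prop)).inter (isOpen_lt (by fun_prop) (by fun_prop))
      have hd : DifferentiableOn ℂ (transfer b c lam k) U := by
        refine Complex.differentiableOn_tsum_of_summable_norm
          (hk.mul_right (12 * (1 + 1 / b))) (fun j => ?_) hUo fun j s hs => ?_
        · intro s hs
          obtain ⟨hs1, hsc⟩ := max_lt_iff.1 (show max 1 (4 * c ^ 2 / b) < ‖s‖ from hs.2)
          have hne : charPoly b c (lam j) s ≠ 0 := by
            intro h
            have h1 := norm_charPoly_ge hb (hl j) (le_of_lt hs.1) hsc.le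
            rw [h, norm_zero] at h1
            have := mul_pos hb (hl j)
            have : 0 < ‖s‖ * (‖s‖ + b * lam j) / 12 := by positivity
            linarith
          have hdp : DifferentiableAt ℂ (charPoly b c (lam j)) s := by
            unfold charPoly; fun_prop
          exact ((differentiableAt_const _).div hdp hne).differentiableWithinAt
        · obtain ⟨hs1, hsc⟩ := max_lt_iff.1 (show max 1 (4 * c ^ 2 / b) < ‖s‖ from hs.2)
          exact norm_transfer_term_le hb hl (le_of_lt hs.1) hsc.le hs1.le j
      exact hd.differentiableAt (hUo.mem_nhds ⟨hs, hsm⟩)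
    · refine le_max_of_le_right ?_
      exact tsum_of_norm_bounded (hk.mul_right _).hasSum
        (norm_transfer_term_le hb hl hs.le hsc.le hs1.le)
    · exact le_max_of_le_left (norm_truncLaplace_mul_transfer_le hb hl hk hτ hψ1 hz hκ h0 hs.le
        hsc.le hs1.le)
  · simpa using hne

/-- The substitution `ν = x ^ 2 / (b * x + c ^ 2)` turns the transfer function into the resolvent
series `∑ k j * (1 + lam j) / (lam j + ν)`. Its analytic continuation to the slit plane vanishes,
and the limits at the points `-lam m` pick out the eigenspaces. No isolation of the eigenvalues is
needed. -/
theorem tsum_eigenspace_eq_zero (hb : 0 < b) (hc : 0 < c) (hl : ∀ j, 0 < lam j)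
    (hk : Summable fun j => |k j|) {x₀ : ℝ} (hx₀ : 0 < x₀)
    (h : ∀ x : ℝ, x₀ ≤ x → transfer b c lam k (x : ℂ) = 0) (m : ℕ) :
    ∑' j, (if lam j = lam m then k j * (1 + lam j) else 0) = 0 := by
  set S : ℂ → ℂ := fun ν => ∑' j, (k j : ℂ) * (1 + lam j) / (lam j + ν) with hS
  have hnorm1 : ∀ j, ‖(1 : ℂ) + lam j‖ = 1 + lam j := by
    intro j
    have := hl j
    rw [← Complex.ofReal_one, ← Complex.ofReal_add, Complex.norm_real,
      Real.norm_of_nonneg (by linarith)]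
  have hslit : ∀ j, -(lam j : ℂ) ∉ Complex.slitPlane := by
    intro j hj
    rw [← Complex.ofReal_neg, Complex.ofReal_mem_slitPlane] at hj
    linarith [hl j]
  have hSd : DifferentiableOn ℂ S Complex.slitPlane := by
    intro ν hν
    obtain ⟨δ, hδ, hball⟩ := Metric.isOpen_iff.1 Complex.isOpen_slitPlane ν hν
    have hlow : ∀ μ ∈ Metric.ball ν (δ / 2), ∀ j, δ / 2 ≤ ‖(lam j : ℂ) + μ‖ := by
      intro μ hμ j
      by_contra hcon
      push Not at hcon
      refine hslit j (hball ?_)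
      rw [Metric.mem_ball, dist_eq_norm] at hμ ⊢
      calc ‖-(lam j : ℂ) - ν‖ = ‖(μ - ν) - (lam j + μ)‖ := by ring_nf
        _ ≤ ‖μ - ν‖ + ‖(lam j : ℂ) + μ‖ := norm_sub_le _ _
        _ < _ := by linarith
    have hd : DifferentiableOn ℂ S (Metric.ball ν (δ / 2)) := by
      refine Complex.differentiableOn_tsum_of_summable_norm
        (hk.mul_right (1 + (1 + (‖ν‖ + δ)) / (δ / 2))) (fun j μ hμ => ?_) Metric.isOpen_ball
        fun j μ hμ => ?_
      · have h1 : (lam j : ℂ) + μ ≠ 0 := by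
          intro h
          have := hlow μ hμ j
          rw [h, norm_zero] at this
          linarith
        exact (DifferentiableAt.div (by fun_prop) (by fun_prop) h1).differentiableWithinAt
      · have h1 := hlow μ hμ j
        have h2 : 0 < ‖(lam j : ℂ) + μ‖ := by linarith
        have hμn : ‖μ‖ ≤ ‖ν‖ + δ := by
          rw [Metric.mem_ball, dist_eq_norm] at hμ
          calc ‖μ‖ = ‖ν + (μ - ν)‖ := by ring_nf
            _ ≤ ‖ν‖ + ‖μ - ν‖ := norm_add_le _ _
            _ ≤ _ := by linarith
        have h3 : 1 + lam j ≤ ‖(lam j : ℂ) + μ‖ + (1 + (‖ν‖ + δ)) := by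
          have : lam j ≤ ‖(lam j : ℂ) + μ‖ + ‖μ‖ := by
            calc lam j = ‖(lam j : ℂ)‖ := by
                  rw [Complex.norm_real, Real.norm_of_nonneg (hl j).le]
              _ = ‖(lam j : ℂ) + μ - μ‖ := by ring_nf
              _ ≤ _ := norm_sub_le _ _
          linarith
        rw [norm_div, norm_mul, hnorm1, Complex.norm_real, mul_div_assoc, Real.norm_eq_abs]
        gcongr
        calc (1 + lam j) / ‖(lam j : ℂ) + μ‖
            ≤ (‖(lam j : ℂ) + μ‖ + (1 + (‖ν‖ + δ))) / ‖(lam j : ℂ) + μ‖ := by gcongr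
          _ = 1 + (1 + (‖ν‖ + δ)) / ‖(lam j : ℂ) + μ‖ := by field_simp
          _ ≤ _ := by
            have := norm_nonneg ν
            gcongr
    exact (hd.differentiableAt (Metric.isOpen_ball.mem_nhds
      (Metric.mem_ball_self (by linarith)))).differentiableWithinAt
  -- the series vanishes at large positive reals
  have hSreal : ∀ ν : ℝ, x₀ / b ≤ ν → S (ν : ℂ) = 0 := by
    intro ν hν
    have hν0 : 0 < ν := lt_of_lt_of_le (by positivity) hν
    -- the positive root of `x ^ 2 = ν * (b * x + c ^ 2)`
    set x := (ν * b + √(ν ^ 2 * b ^ 2 + 4 * ν * c ^ 2)) / 2 with hx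
    have hsq : √(ν ^ 2 * b ^ 2 + 4 * ν * c ^ 2) ^ 2 = ν ^ 2 * b ^ 2 + 4 * ν * c ^ 2 :=
      Real.sq_sqrt (by positivity)
    have hge : ν * b ≤ √(ν ^ 2 * b ^ 2 + 4 * ν * c ^ 2) := by
      apply Real.le_sqrt_of_sq_le
      have : 0 ≤ 4 * ν * c ^ 2 := by positivity
      nlinarith
    have hxν : x ^ 2 = ν * (b * x + c ^ 2) := by
      rw [hx]; nlinarith
    have hxx : x₀ ≤ x := by
      rw [div_le_iff₀ hb] at hν
      rw [hx]; linarith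
    have hpos : 0 < b * x + c ^ 2 := by
      have : 0 < x := hx₀.trans_le hxx
      positivity
    have h1 := h x hxx
    have h2 : transfer b c lam k (x : ℂ) = ((b * x + c ^ 2 : ℝ) : ℂ)⁻¹ * S ν := by
      rw [transfer, hS]
      simp only
      rw [← tsum_mul_left]
      refine tsum_congr fun j => ?_
      have h3 : charPoly b c (lam j) x = ((b * x + c ^ 2 : ℝ) : ℂ) * (lam j + ν) := by
        have h4 : (x : ℂ) ^ 2 = ν * (b * x + c ^ 2) := by exact_mod_cast congrArg Complex.ofReal hxν
        rw [charPoly, h4]; push_cast; ring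
      rw [h3, div_mul_eq_div_div_swap, div_eq_inv_mul _ ((b * x + c ^ 2 : ℝ) : ℂ)]
    rw [h1] at h2
    have h5 : ((b * x + c ^ 2 : ℝ) : ℂ)⁻¹ ≠ 0 := inv_ne_zero (by exact_mod_cast hpos.ne')
    exact (mul_eq_zero.1 h2.symm).resolve_left h5
  have hS0 : EqOn S 0 Complex.slitPlane := by
    set ν₀ : ℝ := x₀ / b + 1 with hν₀
    have hpos : 0 < ν₀ := by positivity
    have hconn : IsPreconnected Complex.slitPlane :=
      (Complex.starConvex_one_slitPlane.isPathConnected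
        Complex.one_mem_slitPlane).isConnected.isPreconnected
    have hSa := hSd.analyticOnNhd Complex.isOpen_slitPlane
    refine hSa.eqOn_zero_of_preconnected_of_frequently_eq_zero hconn
      (z₀ := (ν₀ : ℂ)) (Complex.ofReal_mem_slitPlane.2 hpos) ?_
    have h1 : Tendsto (fun x : ℝ => (x : ℂ)) (𝓝[≠] ν₀) (𝓝[≠] (ν₀ : ℂ)) := by
      refine tendsto_nhdsWithin_iff.2
        ⟨(Complex.continuous_ofReal.tendsto ν₀).mono_left nhdsWithin_le_nhds, ?_⟩
      filter_upwards [self_mem_nhdsWithin] with x hx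
      simpa using hx
    refine h1.frequently (Eventually.frequently ?_)
    have h2 : Ioi (x₀ / b) ∈ 𝓝 ν₀ := Ioi_mem_nhds (by linarith)
    filter_upwards [mem_nhdsWithin_of_mem_nhds h2] with x hx
    exact hSreal x (le_of_lt hx)
  -- the limit along `-lam m + I * y`
  have hlim : Tendsto (fun y : ℝ => ∑' j, (k j : ℂ) * (1 + lam j) *
      ((Complex.I * y) / (lam j + (-lam m + Complex.I * y)))) (𝓝[>] 0)
      (𝓝 (∑' j, ((if lam j = lam m then k j * (1 + lam j) else 0 : ℝ) : ℂ))) := by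
    refine tendsto_tsum_of_dominated_convergence (bound := fun j => |k j| * (2 + lam m))
      (hk.mul_right _) (fun j => ?_) ?_
    · by_cases hj : lam j = lam m
      · rw [if_pos hj]
        refine tendsto_const_nhds.congr' ?_
        filter_upwards [self_mem_nhdsWithin] with y hy
        have hy' : (y : ℂ) ≠ 0 := by exact_mod_cast (ne_of_gt hy)
        rw [hj]
        have h1 : (lam m : ℂ) + (-lam m + Complex.I * y) = Complex.I * y := by ring
        rw [h1, div_self (mul_ne_zero Complex.I_ne_zero hy')]
        push_cast
        ring
      · rw [if_neg hj]
        have hne : (lam j : ℂ) + (-lam m + Complex.I * (0 : ℝ)) ≠ 0 := by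
          intro h
          apply hj
          have h2 : (lam j : ℂ) = lam m := by
            simp only [Complex.ofReal_zero, mul_zero, add_zero] at h
            linear_combination h
          exact_mod_cast h2
        have hcont : ContinuousAt (fun y : ℝ => (k j : ℂ) * (1 + lam j) *
            ((Complex.I * y) / (lam j + (-lam m + Complex.I * y)))) 0 := by
          refine ContinuousAt.mul continuousAt_const (ContinuousAt.div ?_ ?_ hne) <;> fun_prop
        have := hcont.tendsto.mono_left (nhdsWithin_le_nhds (s := Ioi 0))
        simpa using this
    · filter_upwards [Ioo_mem_nhdsGT one_pos] with y hy j
      have hre : ((lam j : ℂ) + (-lam m + Complex.I * y)).re = lam j - lam m := by simp; ring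
      have him : ((lam j : ℂ) + (-lam m + Complex.I * y)).im = y := by simp
      set q := (lam j : ℂ) + (-lam m + Complex.I * y) with hq
      have h1 : y ≤ ‖q‖ := by
        have := Complex.abs_im_le_norm q
        rw [him, abs_of_pos hy.1] at this
        exact this
      have h2 : |lam j - lam m| ≤ ‖q‖ := by
        have := Complex.abs_re_le_norm q
        rwa [hre] at this
      have hq0 : 0 < ‖q‖ := hy.1.trans_le h1
      have hlm := hl m
      rw [norm_mul, norm_mul, hnorm1, norm_div, norm_mul, Complex.norm_I, one_mul,
        Complex.norm_real, Complex.norm_real, Real.norm_eq_abs, Real.norm_of_nonneg hy.1.le,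
        mul_assoc]
      gcongr
      rw [mul_div_assoc', div_le_iff₀ hq0]
      have h3 := (le_abs_self _).trans h2
      have h4 := hy.2
      have h5 := hy.1
      nlinarith
  have hzero : ∀ᶠ y : ℝ in 𝓝[>] 0, ∑' j, (k j : ℂ) * (1 + lam j) *
      ((Complex.I * y) / (lam j + (-lam m + Complex.I * y))) = 0 := by
    filter_upwards [self_mem_nhdsWithin] with y hy
    have hmem : -(lam m : ℂ) + Complex.I * y ∈ Complex.slitPlane := by
      rw [Complex.mem_slitPlane_iff]
      right
      simpa using (ne_of_gt hy)
    have h1 : S (-(lam m : ℂ) + Complex.I * y) = 0 := hS0 hmem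
    rw [← mul_zero (Complex.I * y), ← h1, hS, ← tsum_mul_left]
    refine tsum_congr fun j => ?_
    ring
  have hfin := tendsto_nhds_unique (hlim.congr' hzero) tendsto_const_nhds
  rw [← Complex.ofReal_tsum] at hfin
  exact_mod_cast hfin

end Spectral

/-! ### Existence: superposition of modes -/

section Existence

open Filter Topology

variable {H : Type*} [NormedAddCommGroup H] [InnerProductSpace ℝ H]
  {A : H →ₗ.[ℝ] H} {lam : ℕ → ℝ} {φ : HilbertBasis ℕ ℝ H}

lemma ext_inner_basis (φ : HilbertBasis ℕ ℝ H) {u v : H}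
    (h : ∀ j, inner ℝ (φ j) u = inner ℝ (φ j) v) : u = v := by
  apply φ.repr.injective
  ext j
  rw [φ.repr_apply_apply, φ.repr_apply_apply, h j]

/-- Riesz–Fischer: square summable coefficients define an element of the Hilbert space. -/
lemma hasSum_of_summable_sq (φ : HilbertBasis ℕ ℝ H) {k : ℕ → ℝ}
    (hk : Summable fun j => k j ^ 2) :
    HasSum (fun j => k j • φ j) (∑' j, k j • φ j) ∧
      (∀ j, inner ℝ (φ j) (∑' j, k j • φ j) = k j) ∧ ‖∑' j, k j • φ j‖ ^ 2 = ∑' j, k j ^ 2 := by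
  have hmem : Memℓp k 2 := by
    apply memℓp_gen
    simpa using hk
  set F : lp (fun _ : ℕ => ℝ) 2 := ⟨k, hmem⟩ with hF
  have h1 : HasSum (fun j => k j • φ j) (φ.repr.symm F) := φ.hasSum_repr_symm F
  rw [h1.tsum_eq]
  refine ⟨h1, fun j => ?_, ?_⟩
  · rw [← φ.repr_apply_apply, LinearIsometryEquiv.apply_symm_apply]
  · rw [LinearIsometryEquiv.norm_map]
    have := lp.norm_rpow_eq_tsum (p := 2) (by norm_num) F
    simpa using this

/-- A series of time dependent coefficients that are bounded in `L²` in time, with square summable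
weights, converges in `L²` in time with values in the Hilbert space. -/
lemma memLp_two_tsum {φ : HilbertBasis ℕ ℝ H} {a : ℕ → ℝ} (ha : Summable fun j => a j ^ 2)
    {μ : Measure ℝ} {m : ℕ → ℝ → ℝ} {C : ℝ} (hm : ∀ j, MemLp (m j) 2 μ)
    (hC : ∀ j, ∫ t, m j t ^ 2 ∂μ ≤ C) :
    MemLp (fun t => ∑' j, (a j * m j t) • φ j) 2 μ ∧
      ∀ᵐ t ∂μ, ∀ j, inner ℝ (φ j) (∑' j, (a j * m j t) • φ j) = a j * m j t := by
  have hint : ∀ j, Integrable (fun t => (a j * m j t) ^ 2) μ := fun j => by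
    simpa [mul_pow] using! ((hm j).integrable_sq.const_mul (a j ^ 2))
  have hint2 : ∀ j, ∫ t, (a j * m j t) ^ 2 ∂μ ≤ a j ^ 2 * C := fun j => by
    simp only [mul_pow]
    rw [integral_const_mul]
    exact mul_le_mul_of_nonneg_left (hC j) (sq_nonneg _)
  have hsum : Summable fun j => ∫ t, ‖(a j * m j t) ^ 2‖ ∂μ := by
    refine Summable.of_nonneg_of_le (fun j => integral_nonneg fun t => norm_nonneg _)
      (fun j => ?_) (ha.mul_right C)
    simpa only [Real.norm_eq_abs, abs_pow, sq_abs] using hint2 j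
  have hfin : ∫⁻ t, ∑' j, ‖(a j * m j t) ^ 2‖ₑ ∂μ ≠ ⊤ := by
    have h1 : ∑' j, ∫⁻ t, ‖(a j * m j t) ^ 2‖ₑ ∂μ ≠ ⊤ := by
      have h2 : ∀ j, ∫⁻ t, ‖(a j * m j t) ^ 2‖ₑ ∂μ
          = ENNReal.ofReal (∫ t, ‖(a j * m j t) ^ 2‖ ∂μ) := fun j => by
        rw [ofReal_integral_norm_eq_lintegral_enorm (hint j)]
      simp only [h2]
      rw [← ENNReal.ofReal_tsum_of_nonneg (fun j => integral_nonneg fun t => norm_nonneg _) hsum]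
      exact ENNReal.ofReal_ne_top
    rwa [← lintegral_tsum fun j => (hint j).1.enorm] at h1
  have hae : ∀ᵐ t ∂μ, Summable fun j => (a j * m j t) ^ 2 := by
    have h3 := ae_lt_top' (AEMeasurable.tsum fun j => (hint j).1.enorm) hfin
    filter_upwards [h3] with t ht
    have : Summable fun j => ‖(a j * m j t) ^ 2‖₊ := by
      rw [← ENNReal.tsum_coe_ne_top_iff_summable]
      exact ht.ne
    exact Summable.of_norm (NNReal.summable_coe.2 this)
  have hmeas : AEStronglyMeasurable (fun t => ∑' j, (a j * m j t) • φ j) μ := by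
    refine aestronglyMeasurable_of_tendsto_ae atTop
      (f := fun n t => ∑ j ∈ Finset.range n, (a j * m j t) • φ j) (fun n => ?_) ?_
    · exact Finset.aestronglyMeasurable_fun_sum _ fun j _ =>
        ((hm j).1.const_mul _).smul aestronglyMeasurable_const
    · filter_upwards [hae] with t ht
      exact (hasSum_of_summable_sq φ ht).1.tendsto_sum_nat
  refine ⟨(memLp_two_iff_integrable_sq_norm hmeas).2 ?_, ?_⟩
  · refine ⟨hmeas.norm.pow 2, lt_of_le_of_lt (lintegral_mono_ae ?_) hfin.lt_top⟩
    filter_upwards [hae] with t ht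
    rw [(hasSum_of_summable_sq φ ht).2.2]
    exact enorm_tsum_le_tsum_enorm
  · filter_upwards [hae] with t ht
    exact (hasSum_of_summable_sq φ ht).2.1

/-- A vector is a Bochner integral as soon as its coefficients are the integrals of the
coefficients. -/
lemma eq_integral_of_inner [CompleteSpace H] (φ : HilbertBasis ℕ ℝ H) {V : ℝ → H} {v : H} {t : ℝ}
    (ht : 0 ≤ t) (hV : IntegrableOn V (Ioc 0 t)) {q : ℕ → ℝ → ℝ}
    (hq : ∀ᵐ s ∂(volume.restrict (Ioc 0 t)), ∀ j, inner ℝ (φ j) (V s) = q j s)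
    (hv : ∀ j, inner ℝ (φ j) v = ∫ s in (0 : ℝ)..t, q j s) : v = ∫ s in (0 : ℝ)..t, V s := by
  refine ext_inner_basis φ fun j => ?_
  have h1 := (innerSL ℝ (φ j)).integral_comp_comm hV
  simp only [innerSL_apply_apply] at h1
  rw [hv, intervalIntegral.integral_of_le ht, intervalIntegral.integral_of_le ht, ← h1]
  refine integral_congr_ae ?_
  filter_upwards [hq] with s hs
  exact (hs j).symm

lemma ae_restrict_Ioi_of_forall_Ioc {P : ℝ → Prop}
    (hP : ∀ τ : ℝ, ∀ᵐ t ∂(volume.restrict (Ioc 0 τ)), P t) :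
    ∀ᵐ t ∂(volume.restrict (Ioi (0 : ℝ))), P t := by
  have : Ioi (0 : ℝ) = ⋃ n : ℕ, Ioc (0 : ℝ) n := by
    ext t
    simp only [mem_Ioi, mem_iUnion, mem_Ioc]
    exact ⟨fun h => (exists_nat_ge t).imp fun n hn => ⟨h, hn⟩, fun ⟨n, h, _⟩ => h⟩
  rw [this, ae_restrict_iUnion_iff]
  exact fun n => hP n

lemma memLp_two_of_continuous {F : ℝ → ℝ} (hF : Continuous F) (τ : ℝ) :
    MemLp F 2 (volume.restrict (Ioc 0 τ)) := by
  rw [memLp_two_iff_integrable_sq hF.aestronglyMeasurable]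
  exact (hF.pow 2).integrableOn_Ioc

/-- The superposition of the modes with weights `a j` solves the damped wave equation with forcing
`ψ t • ∑ j, a j • φ j`. -/
lemma exists_modal_solution [CompleteSpace H] {b c : ℝ} (hb : 0 < b) (hc : 0 < c)
    (hA : IsSelfAdjoint A) (hφ : ∀ j, (φ j, lam j • φ j) ∈ A.graph) (hl : ∀ j, 0 < lam j)
    {ψ : ℝ → ℝ} (hψ : ∀ τ : ℝ, MemLp ψ 2 (volume.restrict (Ioc 0 τ))) {z w : ℕ → ℝ → ℝ}
    (hz : ∀ j, IsModeSolution b c (lam j) ψ (z j) (w j)) (G : H) :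
    ∃ u ut utt Au Aut : ℝ → H,
      (∀ τ : ℝ, MemLp utt 2 (volume.restrict (Ioc 0 τ))) ∧
      (∀ t : ℝ, 0 ≤ t → ut t = ∫ s in (0 : ℝ)..t, utt s) ∧
      (∀ t : ℝ, 0 ≤ t → u t = ∫ s in (0 : ℝ)..t, ut s) ∧
      (∀ t : ℝ, 0 ≤ t → (u t, Au t) ∈ A.graph) ∧
      (∀ᵐ t ∂(volume.restrict (Ioi (0 : ℝ))), (ut t, Aut t) ∈ A.graph) ∧
      (∀ τ : ℝ, MemLp Aut 2 (volume.restrict (Ioc 0 τ))) ∧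
      (∀ᵐ t ∂(volume.restrict (Ioi (0 : ℝ))), utt t + c ^ 2 • Au t + b • Aut t = ψ t • G) ∧
      ∀ t : ℝ, 0 ≤ t → ∀ j, inner ℝ (φ j) (u t) = inner ℝ (φ j) G * z j t := by
  set a : ℕ → ℝ := fun j => inner ℝ (φ j) G with ha
  have hasum : Summable fun j => a j ^ 2 := by
    simpa only [Real.norm_eq_abs, sq_abs] using φ.orthonormal.inner_products_summable (x := G)
  have hzc : ∀ j, Continuous (z j) := fun j =>
    continuous_iff_continuousAt.2 fun t => ((hz j).1 t).continuousAt
  have hwc : ∀ j, Continuous (w j) := fun j =>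
    continuous_iff_continuousAt.2 fun t => ((hz j).2 t).continuousAt
  set m : ℕ → ℝ → ℝ := fun j t => ψ t - b * lam j * w j t - c ^ 2 * lam j * z j t with hm
  have hmL : ∀ τ j, MemLp (m j) 2 (volume.restrict (Ioc 0 τ)) := fun τ j =>
    ((hψ τ).sub (memLp_two_of_continuous ((hwc j).const_mul _) τ)).sub
      (memLp_two_of_continuous ((hzc j).const_mul _) τ)
  have hutt : ∀ τ : ℝ, MemLp (fun t => ∑' j, (a j * m j t) • φ j) 2 (volume.restrict (Ioc 0 τ)) ∧
      ∀ᵐ t ∂(volume.restrict (Ioc 0 τ)),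
        ∀ j, inner ℝ (φ j) (∑' j, (a j * m j t) • φ j) = a j * m j t := by
    intro τ
    rcases le_total 0 τ with hτ | hτ
    · obtain ⟨K, hK0, hK⟩ := exists_mode_bound hb hc hτ (hψ τ)
      exact memLp_two_tsum hasum (hmL τ) fun j => (hK _ (hl j) _ _ (hz j)).2.2
    · rw [Ioc_eq_empty (not_lt.2 hτ)]
      simp
  have hAut : ∀ τ : ℝ, MemLp (fun t => ∑' j, (a j * (lam j * w j t)) • φ j) 2
      (volume.restrict (Ioc 0 τ)) ∧ ∀ᵐ t ∂(volume.restrict (Ioc 0 τ)),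
        ∀ j, inner ℝ (φ j) (∑' j, (a j * (lam j * w j t)) • φ j) = a j * (lam j * w j t) := by
    intro τ
    rcases le_total 0 τ with hτ | hτ
    · obtain ⟨K, hK0, hK⟩ := exists_mode_bound hb hc hτ (hψ τ)
      exact memLp_two_tsum hasum (fun j => memLp_two_of_continuous ((hwc j).const_mul _) τ)
        fun j => (hK _ (hl j) _ _ (hz j)).2.1
    · rw [Ioc_eq_empty (not_lt.2 hτ)]
      simp
  -- pointwise bounds on the coefficients
  have hsq : ∀ {q : ℕ → ℝ} {K : ℝ}, (∀ j, q j ^ 2 ≤ K) → Summable fun j => (a j * q j) ^ 2 := by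
    intro q K hq
    refine Summable.of_nonneg_of_le (fun j => sq_nonneg _) (fun j => ?_) (hasum.mul_right K)
    rw [mul_pow]
    exact mul_le_mul_of_nonneg_left (hq j) (sq_nonneg _)
  have hu : ∀ t : ℝ, 0 ≤ t → ∀ j, inner ℝ (φ j) (∑' j, (a j * z j t) • φ j) = a j * z j t := by
    intro t ht
    obtain ⟨K, hK0, hK⟩ := exists_mode_bound hb hc ht (hψ t)
    refine (hasSum_of_summable_sq φ (hsq (K := K) fun j => ?_)).2.1
    refine le_trans ?_ ((hK _ (hl j) _ _ (hz j)).1 t ⟨ht, le_rfl⟩).2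
    rw [mul_pow]
    nlinarith [sq_nonneg (z j t), hl j, mul_nonneg (hl j).le (sq_nonneg (z j t)),
      mul_nonneg (sq_nonneg (lam j)) (sq_nonneg (z j t))]
  have hut : ∀ t : ℝ, 0 ≤ t → ∀ j, inner ℝ (φ j) (∑' j, (a j * w j t) • φ j) = a j * w j t := by
    intro t ht
    obtain ⟨K, hK0, hK⟩ := exists_mode_bound hb hc ht (hψ t)
    exact (hasSum_of_summable_sq φ (hsq (K := K)
      fun j => ((hK _ (hl j) _ _ (hz j)).1 t ⟨ht, le_rfl⟩).1)).2.1
  have hAu : ∀ t : ℝ, 0 ≤ t → ∀ j,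
      inner ℝ (φ j) (∑' j, (a j * (lam j * z j t)) • φ j) = a j * (lam j * z j t) := by
    intro t ht
    obtain ⟨K, hK0, hK⟩ := exists_mode_bound hb hc ht (hψ t)
    refine (hasSum_of_summable_sq φ (hsq (K := K) fun j => ?_)).2.1
    refine le_trans ?_ ((hK _ (hl j) _ _ (hz j)).1 t ⟨ht, le_rfl⟩).2
    rw [mul_pow, mul_pow]
    have := hl j
    gcongr
    linarith
  have hutm : ∀ t : ℝ, 0 ≤ t → IntegrableOn (fun t => ∑' j, (a j * w j t) • φ j) (Ioc 0 t) := by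
    intro t ht
    obtain ⟨K, hK0, hK⟩ := exists_mode_bound hb hc ht (hψ t)
    refine (memLp_two_tsum (C := K * t) hasum (fun j => memLp_two_of_continuous (hwc j) t)
      fun j => ?_).1.integrable (by norm_num)
    have h1 : ∫ s in Ioc 0 t, w j s ^ 2 ≤ ∫ s in Ioc 0 t, K :=
      setIntegral_mono_on ((hwc j).pow 2).integrableOn_Ioc (integrable_const _) measurableSet_Ioc
        fun s hs => ((hK _ (hl j) _ _ (hz j)).1 s ⟨hs.1.le, hs.2⟩).1
    simpa [ht, mul_comm] using h1
  have huttm : ∀ τ : ℝ, IntegrableOn (fun t => ∑' j, (a j * m j t) • φ j) (Ioc 0 τ) :=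
    fun τ => (hutt τ).1.integrable (by norm_num)
  refine ⟨_, fun t => ∑' j, (a j * w j t) • φ j, _,
    fun t => ∑' j, (a j * (lam j * z j t)) • φ j, _, fun τ => (hutt τ).1,
    fun t ht => ?_, fun t ht => ?_, fun t ht => ?_, ?_, fun τ => (hAut τ).1, ?_, hu⟩
  · refine eq_integral_of_inner φ ht (huttm t) (hutt t).2 fun j => ?_
    have h1 : IntervalIntegrable (m j) volume 0 t :=
      (intervalIntegrable_iff_integrableOn_Ioc_of_le ht).2 ((hmL t j).integrable (by norm_num))
    rw [hut t ht, intervalIntegral.integral_const_mul,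
      intervalIntegral.integral_eq_sub_of_hasDerivAt (fun s _ => (hz j).2 s) h1, (hz j).4, sub_zero]
  · refine eq_integral_of_inner φ ht (hutm t ht) (q := fun j s => a j * w j s) ?_ fun j => ?_
    · filter_upwards [ae_restrict_mem measurableSet_Ioc] with s hs
      exact hut s hs.1.le
    · rw [hu t ht, intervalIntegral.integral_const_mul,
        intervalIntegral.integral_eq_sub_of_hasDerivAt (fun s _ => (hz j).1 s)
          ((hwc j).intervalIntegrable _ _), (hz j).3, sub_zero]
  · refine mem_graph_of_inner hA hφ fun j => ?_
    rw [hAu t ht, hu t ht]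
    ring
  · filter_upwards [ae_restrict_Ioi_of_forall_Ioc fun τ => (hAut τ).2,
      ae_restrict_mem measurableSet_Ioi] with t h1 ht
    refine mem_graph_of_inner hA hφ fun j => ?_
    rw [h1, hut t (le_of_lt ht)]
    ring
  · filter_upwards [ae_restrict_Ioi_of_forall_Ioc fun τ => (hAut τ).2,
      ae_restrict_Ioi_of_forall_Ioc fun τ => (hutt τ).2,
      ae_restrict_mem measurableSet_Ioi] with t h1 h2 ht
    refine ext_inner_basis φ fun j => ?_
    rw [inner_add_right, inner_add_right, inner_smul_right, inner_smul_right, inner_smul_right,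
      h1, h2, hAu t (le_of_lt ht)]
    simp only [ha, hm]
    ring

end Existence

/-! ### Uniqueness of strong solutions -/

section Uniqueness

open Filter Topology

/-- Energy argument for the homogeneous oscillator in integrated form: `v ^ 2 + c ^ 2 * l * w ^ 2`
is nonincreasing. -/
lemma eq_zero_of_homogeneous_oscillator {b c l : ℝ} (hb : 0 < b) (hc : 0 < c) (hl : 0 < l)
    {y v w : ℝ → ℝ} (hy : ∀ τ : ℝ, IntegrableOn y (Ioc 0 τ))
    (hv : ∀ t, 0 ≤ t → v t = ∫ s in (0 : ℝ)..t, y s)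
    (hw : ∀ t, 0 ≤ t → w t = ∫ s in (0 : ℝ)..t, v s)
    (h : ∀ᵐ t ∂(volume.restrict (Ioi (0 : ℝ))), y t + c ^ 2 * l * w t + b * l * v t = 0) :
    ∀ t, 0 ≤ t → v t = 0 ∧ w t = 0 := by
  -- extend `y` by zero to negative times, so that the primitives are defined on the whole line
  set y' : ℝ → ℝ := (Ioi 0).indicator y with hy'
  have hyi : ∀ p q : ℝ, IntervalIntegrable y' volume p q := by
    have h1 : ∀ q : ℝ, IntegrableOn y' (Iic q) := by
      intro q
      rw [hy', IntegrableOn, integrable_indicator_iff measurableSet_Ioi, IntegrableOn,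
        Measure.restrict_restrict measurableSet_Ioi, Ioi_inter_Iic]
      exact hy q
    intro p q
    exact ⟨(h1 q).mono_set Ioc_subset_Iic_self, (h1 p).mono_set Ioc_subset_Iic_self⟩
  set V : ℝ → ℝ := fun t => ∫ s in (0 : ℝ)..t, y' s with hV
  have hVc : Continuous V := intervalIntegral.continuous_primitive hyi 0
  set W : ℝ → ℝ := fun t => ∫ s in (0 : ℝ)..t, V s with hW
  have hWd : ∀ t, HasDerivAt W (V t) t := fun t => (hVc.integral_hasStrictDerivAt 0 t).hasDerivAt
  have hWc : Continuous W := continuous_iff_continuousAt.2 fun t => (hWd t).continuousAt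
  have hvV : ∀ t, 0 ≤ t → v t = V t := by
    intro t ht
    rw [hv t ht, hV]
    simp only
    rw [intervalIntegral.integral_of_le ht, intervalIntegral.integral_of_le ht]
    refine setIntegral_congr_fun measurableSet_Ioc fun s hs => ?_
    exact (indicator_of_mem (show s ∈ Ioi 0 from hs.1) y).symm
  have hwW : ∀ t, 0 ≤ t → w t = W t := by
    intro t ht
    rw [hw t ht, hW]
    refine intervalIntegral.integral_congr fun s hs => ?_
    rw [uIcc_of_le ht] at hs
    exact hvV s hs.1
  set F : ℝ → ℝ := fun t => -(c ^ 2 * l * W t + b * l * V t) with hF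
  have hFc : Continuous F := by fun_prop
  have hVF : ∀ t, 0 ≤ t → V t = ∫ s in (0 : ℝ)..t, F s := by
    intro t ht
    rw [← hvV t ht, hv t ht, intervalIntegral.integral_of_le ht, intervalIntegral.integral_of_le ht]
    refine integral_congr_ae ?_
    have h1 := ae_restrict_of_ae_restrict_of_subset (show Ioc 0 t ⊆ Ioi 0 from fun s hs => hs.1) h
    filter_upwards [h1, ae_restrict_mem measurableSet_Ioc] with s h2 hs
    rw [hvV s hs.1.le, hwW s hs.1.le] at h2
    rw [hF]
    linarith
  have hVd : ∀ t, 0 < t → HasDerivAt V (F t) t := by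
    intro t ht
    refine (hFc.integral_hasStrictDerivAt 0 t).hasDerivAt.congr_of_eventuallyEq ?_
    filter_upwards [Ioi_mem_nhds ht] with s hs
    exact hVF s (le_of_lt hs)
  have hed : ∀ t, 0 < t → HasDerivAt (fun t => V t ^ 2 + c ^ 2 * l * W t ^ 2)
      (-(2 * b * l * V t ^ 2)) t := by
    intro t ht
    refine (((hVd t ht).pow 2).add (((hWd t).pow 2).const_mul (c ^ 2 * l))).congr_deriv ?_
    simp only [hF]
    push_cast
    ring
  have hanti : AntitoneOn (fun t => V t ^ 2 + c ^ 2 * l * W t ^ 2) (Ici 0) := by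
    refine antitoneOn_of_deriv_nonpos (convex_Ici 0) (by fun_prop) (fun t ht => ?_) fun t ht => ?_
    · rw [interior_Ici] at ht
      exact (hed t ht).differentiableAt.differentiableWithinAt
    · rw [interior_Ici] at ht
      rw [(hed t ht).deriv]
      have : 0 ≤ 2 * b * l * V t ^ 2 := by positivity
      linarith
  intro t ht
  have h1 := hanti (mem_Ici.2 le_rfl) (mem_Ici.2 ht) ht
  have h2 : V 0 = 0 := by simp [hV]
  have h3 : W 0 = 0 := by simp [hW]
  simp only [h2, h3] at h1
  have hcl : 0 < c ^ 2 * l := by positivity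
  have h4 : V t ^ 2 = 0 := by
    nlinarith [sq_nonneg (V t), mul_nonneg hcl.le (sq_nonneg (W t))]
  have h5 : c ^ 2 * l * W t ^ 2 = 0 := by
    nlinarith [sq_nonneg (V t), mul_nonneg hcl.le (sq_nonneg (W t))]
  rw [hvV t ht, hwW t ht]
  exact ⟨by simpa using h4, by simpa [hcl.ne'] using h5⟩

variable {d : ℕ} {Ω : Set (E d)} {A : L2 Ω →ₗ.[ℝ] L2 Ω} {b c : ℝ} {lam : ℕ → ℝ}
  {φ : HilbertBasis ℕ ℝ (L2 Ω)}

/-- Two strong solutions with the same data coincide: the coefficients of the difference solve the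
homogeneous oscillator, and the equation then determines the second derivative. -/
lemma IsStrongSolution.eqOn (hb : 0 < b) (hc : 0 < c) (hA : IsSelfAdjoint A)
    (hφ : ∀ j, (φ j, lam j • φ j) ∈ A.graph) (hl : ∀ j, 0 < lam j)
    {g g' : ℝ → E d → ℝ} {u₀ u₁ : L2 Ω} {u ut utt u' ut' utt' : ℝ → L2 Ω}
    (hg : ∀ᵐ t ∂(volume.restrict (Ioi (0 : ℝ))), g t =ᵐ[volume.restrict Ω] g' t)
    (h : IsStrongSolution A c b g u₀ u₁ u ut utt)
    (h' : IsStrongSolution A c b g' u₀ u₁ u' ut' utt') :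
    (∀ t, 0 ≤ t → u t = u' t ∧ ut t = ut' t) ∧
      ∀ᵐ t ∂(volume.restrict (Ioi (0 : ℝ))), utt t = utt' t := by
  obtain ⟨Au, Aut, hAu, hAut, -, heq⟩ := h.equation
  obtain ⟨Au', Aut', hAu', hAut', -, heq'⟩ := h'.equation
  have hdiff : ∀ᵐ t ∂(volume.restrict (Ioi (0 : ℝ))),
      utt t + c ^ 2 • Au t + b • Aut t = utt' t + c ^ 2 • Au' t + b • Aut' t := by
    filter_upwards [hg, heq, heq'] with t h1 h2 h3
    refine Lp.ext ?_
    filter_upwards [h1, h2, h3, Lp.coeFn_add (utt t + c ^ 2 • Au t) (b • Aut t),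
      Lp.coeFn_add (utt t) (c ^ 2 • Au t), Lp.coeFn_smul (c ^ 2) (Au t), Lp.coeFn_smul b (Aut t),
      Lp.coeFn_add (utt' t + c ^ 2 • Au' t) (b • Aut' t), Lp.coeFn_add (utt' t) (c ^ 2 • Au' t),
      Lp.coeFn_smul (c ^ 2) (Au' t), Lp.coeFn_smul b (Aut' t)]
      with x e1 e2 e3 e4 e5 e6 e7 f4 f5 f6 f7
    rw [e4, f4, Pi.add_apply, Pi.add_apply, e5, f5, Pi.add_apply, Pi.add_apply, e6, e7, f6, f7]
    simp only [Pi.smul_apply, smul_eq_mul]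
    rw [e2, e3, e1]
  have hi : ∀ τ : ℝ, IntegrableOn utt (Ioc 0 τ) := fun τ =>
    (h.utt_memLp τ).integrable (by norm_num)
  have hi' : ∀ τ : ℝ, IntegrableOn utt' (Ioc 0 τ) := fun τ =>
    (h'.utt_memLp τ).integrable (by norm_num)
  have hcont : ∀ {G : ℝ → L2 Ω} {G₀ : L2 Ω} {G' : ℝ → L2 Ω} (τ : ℝ), IntegrableOn G' (Ioc 0 τ) →
      (∀ t, 0 ≤ t → G t = G₀ + ∫ s in (0 : ℝ)..t, G' s) → IntegrableOn G (Ioc 0 τ) := by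
    intro G G₀ G' τ hG' hG
    rcases le_total 0 τ with hτ | hτ
    · have h1 : ContinuousOn (fun t => G₀ + ∫ s in (0 : ℝ)..t, G' s) (Icc 0 τ) := by
        refine continuousOn_const.add ?_
        have := intervalIntegral.continuousOn_primitive_interval (μ := volume) (f := G')
          (a := 0) (b := τ) (by rwa [uIcc_of_le hτ, integrableOn_Icc_iff_integrableOn_Ioc])
        rwa [uIcc_of_le hτ] at this
      refine (IntegrableOn.congr_fun h1.integrableOn_Icc (fun t ht => (hG t ht.1).symm)
        measurableSet_Icc).mono_set Ioc_subset_Icc_self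
    · rw [Ioc_eq_empty (not_lt.2 hτ)]
      exact integrableOn_empty
  have hit : ∀ τ : ℝ, IntegrableOn ut (Ioc 0 τ) := fun τ => hcont τ (hi τ) h.ut_eq
  have hit' : ∀ τ : ℝ, IntegrableOn ut' (Ioc 0 τ) := fun τ => hcont τ (hi' τ) h'.ut_eq
  -- the coefficients of the difference
  have hcoef : ∀ j, ∀ t, 0 ≤ t →
      inner ℝ (φ j) (ut t - ut' t) = 0 ∧ inner ℝ (φ j) (u t - u' t) = 0 := by
    intro j
    have hint : ∀ {G G' : ℝ → L2 Ω} {t : ℝ}, 0 ≤ t → IntegrableOn G (Ioc 0 t) →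
        IntegrableOn G' (Ioc 0 t) →
        inner ℝ (φ j) ((∫ s in (0 : ℝ)..t, G s) - ∫ s in (0 : ℝ)..t, G' s)
          = ∫ s in (0 : ℝ)..t, inner ℝ (φ j) (G s - G' s) := by
      intro G G' t ht h1 h2
      rw [intervalIntegral.integral_of_le ht, intervalIntegral.integral_of_le ht,
        intervalIntegral.integral_of_le ht, ← integral_sub h1 h2]
      exact ((innerSL ℝ (φ j)).integral_comp_comm (h1.sub h2)).symm
    refine eq_zero_of_homogeneous_oscillator hb hc (hl j)
      (y := fun t => inner ℝ (φ j) (utt t - utt' t)) (fun τ => ?_) (fun t ht => ?_)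
      (fun t ht => ?_) ?_
    · exact (innerSL ℝ (φ j)).integrable_comp ((hi τ).sub (hi' τ))
    · rw [← hint ht (hi t) (hi' t), h.ut_eq t ht, h'.ut_eq t ht, add_sub_add_left_eq_sub]
    · rw [← hint ht (hit t) (hit' t), h.u_eq t ht, h'.u_eq t ht, add_sub_add_left_eq_sub]
    · filter_upwards [hdiff, hAut, hAut', ae_restrict_mem measurableSet_Ioi] with t e1 e2 e3 ht
      have e4 := congrArg (fun q => (inner ℝ (φ j) q : ℝ)) e1
      simp only [inner_add_right, inner_smul_right] at e4
      rw [inner_basis_graph hA hφ (hAu t (le_of_lt ht)), inner_basis_graph hA hφ e2,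
        inner_basis_graph hA hφ (hAu' t (le_of_lt ht)), inner_basis_graph hA hφ e3] at e4
      simp only [inner_sub_right]
      linear_combination e4
  have h1 : ∀ t, 0 ≤ t → u t = u' t ∧ ut t = ut' t := by
    intro t ht
    constructor
    · refine ext_inner_basis φ fun j => ?_
      have := (hcoef j t ht).2
      rwa [inner_sub_right, sub_eq_zero] at this
    · refine ext_inner_basis φ fun j => ?_
      have := (hcoef j t ht).1
      rwa [inner_sub_right, sub_eq_zero] at this
  refine ⟨h1, ?_⟩
  filter_upwards [hdiff, hAut, hAut', ae_restrict_mem measurableSet_Ioi] with t e1 e2 e3 ht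
  obtain ⟨e4, e5⟩ := h1 t (le_of_lt ht)
  have h2 := hAu t (le_of_lt ht)
  rw [e4] at h2
  rw [e5] at e2
  rw [A.mem_graph_snd_inj h2 (hAu' t (le_of_lt ht)) rfl, A.mem_graph_snd_inj e2 e3 rfl] at e1
  exact add_right_cancel (add_right_cancel e1)

end Uniqueness

/-! ### The linearised forward operator -/

section Forward

open Filter Topology

variable {β : ℝ → ℝ}

lemma deriv_sq_eq (hβ₁ : Differentiable ℝ β) :
    deriv (fun t => β t ^ 2) = fun t => 2 * β t * deriv β t := by
  funext t
  have := ((hβ₁ t).hasDerivAt.pow 2).deriv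
  simpa using! this

lemma hasDerivAt_deriv_sq (hβ₁ : Differentiable ℝ β) (hβ₂ : Differentiable ℝ (deriv β)) (t : ℝ) :
    HasDerivAt (fun t => 2 * β t * deriv β t)
      (2 * (β t * deriv (deriv β) t + deriv β t ^ 2)) t := by
  refine (((hβ₁ t).hasDerivAt.const_mul 2).mul (hβ₂ t).hasDerivAt).congr_deriv ?_
  ring

lemma timeFactor_eq (hβ₁ : Differentiable ℝ β) (hβ₂ : Differentiable ℝ (deriv β)) (t : ℝ) :
    timeFactor β t = 2 * (β t * deriv (deriv β) t + deriv β t ^ 2) := by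
  rw [timeFactor, deriv_sq_eq hβ₁, (hasDerivAt_deriv_sq hβ₁ hβ₂ t).deriv]

lemma memLp_timeFactor (hβ₁ : Differentiable ℝ β) (hβ₂ : Differentiable ℝ (deriv β))
    (hβ₃ : ∀ τ : ℝ, MemLp (deriv (deriv β)) 2 (volume.restrict (Ioc 0 τ))) (τ : ℝ) :
    MemLp (timeFactor β) 2 (volume.restrict (Ioc 0 τ)) := by
  obtain ⟨M, hM⟩ := (isCompact_Icc (a := (0 : ℝ)) (b := τ)).exists_bound_of_continuousOn
    hβ₁.continuous.continuousOn
  have h1 : MemLp (fun t => β t * deriv (deriv β) t) 2 (volume.restrict (Ioc 0 τ)) := by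
    refine (hβ₃ τ).of_le_mul (c := M) (hβ₁.continuous.aestronglyMeasurable.mul (hβ₃ τ).1) ?_
    filter_upwards [ae_restrict_mem measurableSet_Ioc] with t ht
    rw [norm_mul]
    exact mul_le_mul_of_nonneg_right (hM t ⟨ht.1.le, ht.2⟩) (norm_nonneg _)
  have h2 := (h1.add (memLp_two_of_continuous (hβ₂.continuous.pow 2) τ)).const_mul 2
  refine h2.ae_eq (Eventually.of_forall fun t => ?_)
  rw [timeFactor_eq hβ₁ hβ₂]
  rfl

/-- A function whose second derivative vanishes almost everywhere on `(0, τ)` has a constant first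
derivative there, so its second derivative vanishes everywhere on `(0, τ)`. -/
lemma not_ae_timeFactor_eq_zero (hβ₁ : Differentiable ℝ β) (hβ₂ : Differentiable ℝ (deriv β))
    {t₀ τ : ℝ} (ht₀ : 0 < t₀) (hτ : t₀ < τ) (h : timeFactor β t₀ ≠ 0) :
    ¬ ∀ᵐ t ∂(volume.restrict (Ioc 0 τ)), timeFactor β t = 0 := by
  intro hae
  have hd : ∀ t, HasDerivAt (fun t => 2 * β t * deriv β t) (timeFactor β t) t := fun t => by
    rw [timeFactor_eq hβ₁ hβ₂]
    exact hasDerivAt_deriv_sq hβ₁ hβ₂ t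
  apply h
  refine (hd t₀).unique ((hasDerivAt_const t₀ (2 * β 0 * deriv β 0)).congr_of_eventuallyEq ?_)
  filter_upwards [Ioo_mem_nhds ht₀ hτ] with t ht
  have h1 : ∀ᵐ s ∂(volume.restrict (Ioc 0 t)), timeFactor β s = 0 :=
    ae_restrict_of_ae_restrict_of_subset (Ioc_subset_Ioc_right ht.2.le) hae
  have h2 : IntervalIntegrable (timeFactor β) volume 0 t :=
    (intervalIntegrable_iff_integrableOn_Ioc_of_le ht.1.le).2
      ((integrable_zero _ _ _).congr (EventuallyEq.symm h1))
  have h3 := intervalIntegral.integral_eq_sub_of_hasDerivAt (fun s _ => hd s) h2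
  rw [intervalIntegral.integral_of_le ht.1.le, integral_congr_ae h1, integral_zero] at h3
  linarith

variable {d : ℕ} {Ω : Set (E d)} {A : L2 Ω →ₗ.[ℝ] L2 Ω} {b c : ℝ} {lam : ℕ → ℝ}
  {φ : HilbertBasis ℕ ℝ (L2 Ω)}

/-- For `κ = 0` the excitation produces the separated solution `β t • f`. -/
lemma isStrongSolution_excitation (f : A.domain) (hβ₁ : Differentiable ℝ β)
    (hβ₂ : Differentiable ℝ (deriv β))
    (hβ₃ : ∀ τ : ℝ, MemLp (deriv (deriv β)) 2 (volume.restrict (Ioc 0 τ))) :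
    IsStrongSolution A c b (excitation A c b f β) (β 0 • (f : L2 Ω)) (deriv β 0 • (f : L2 Ω))
      (fun t => β t • (f : L2 Ω)) (fun t => deriv β t • (f : L2 Ω))
      (fun t => deriv (deriv β) t • (f : L2 Ω)) where
  utt_memLp τ := (ContinuousLinearMap.toSpanSingleton ℝ (f : L2 Ω)).comp_memLp' (hβ₃ τ)
  ut_eq t ht := by
    have h1 : IntervalIntegrable (deriv (deriv β)) volume 0 t :=
      (intervalIntegrable_iff_integrableOn_Ioc_of_le ht).2 ((hβ₃ t).integrable (by norm_num))
    rw [intervalIntegral.integral_smul_const,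
      intervalIntegral.integral_eq_sub_of_hasDerivAt (fun s _ => (hβ₂ s).hasDerivAt) h1, ← add_smul,
      add_sub_cancel]
  u_eq t ht := by
    rw [intervalIntegral.integral_smul_const,
      intervalIntegral.integral_eq_sub_of_hasDerivAt (fun s _ => (hβ₁ s).hasDerivAt)
        (hβ₂.continuous.intervalIntegrable _ _), ← add_smul, add_sub_cancel]
  equation := by
    refine ⟨fun t => β t • A f, fun t => deriv β t • A f, fun t _ => ?_, ?_, fun τ => ?_, ?_⟩
    · exact A.graph.smul_mem (β t) (A.mem_graph f)
    · exact Eventually.of_forall fun t => A.graph.smul_mem (deriv β t) (A.mem_graph f)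
    · exact (ContinuousLinearMap.toSpanSingleton ℝ (A f)).comp_memLp'
        (memLp_two_of_continuous hβ₂.continuous τ)
    · refine Eventually.of_forall fun t => ?_
      filter_upwards [Lp.coeFn_smul (deriv (deriv β) t) (f : L2 Ω), Lp.coeFn_smul (β t) (A f),
        Lp.coeFn_smul (deriv β t) (A f)] with x h1 h2 h3
      rw [h1, h2, h3, excitation]
      simp only [Pi.smul_apply, smul_eq_mul]
      ring

/-- The spatial factor of the linearised source. The square of `f` is square integrable because `f`
is bounded, by the embedding of `H²` into the continuous functions. -/
lemma exists_source (hd : d ≤ 3) (hΩb : Bornology.IsBounded Ω)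
    (hA : IsEllipticRealisation Ω A) (f : A.domain) (dκ : LInf Ω) :
    ∃ G : L2 Ω, ∀ᵐ x ∂(volume.restrict Ω), G x = dκ x * (f : L2 Ω) x ^ 2 := by
  obtain ⟨q, hq, hfq⟩ := (hA.domain_H2 f f.2).exists_continuous hd
  obtain ⟨M, hM⟩ := hΩb.isCompact_closure.exists_bound_of_continuousOn hq.continuousOn
  have hκ := ae_le_eLpNormEssSup (f := (dκ : E d → ℝ)) (μ := volume.restrict Ω)
  have hκ' : eLpNormEssSup dκ (volume.restrict Ω) < ⊤ := by
    have := Lp.eLpNorm_lt_top dκ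
    rwa [eLpNorm_exponent_top] at this
  have hΩm : ∀ᵐ x ∂(volume.restrict Ω), ‖q x‖ ≤ M := by
    filter_upwards [ae_restrict_of_ae_restrict_of_subset subset_closure
      (ae_restrict_mem isClosed_closure.measurableSet)] with x hx
    exact hM x hx
  have hmem : MemLp (fun x => dκ x * (f : L2 Ω) x ^ 2) 2 (volume.restrict Ω) := by
    refine (Lp.memLp (f : L2 Ω)).of_le_mul
      (c := (eLpNormEssSup dκ (volume.restrict Ω)).toReal * M)
      ((Lp.aestronglyMeasurable dκ).mul ((Lp.aestronglyMeasurable (f : L2 Ω)).pow 2)) ?_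
    filter_upwards [hκ, hΩm, hfq] with x h1 h2 h3
    have h4 : ‖dκ x‖ ≤ (eLpNormEssSup dκ (volume.restrict Ω)).toReal := by
      have := ENNReal.toReal_mono hκ'.ne h1
      simpa using this
    rw [norm_mul, norm_pow, sq, ← mul_assoc]
    refine mul_le_mul_of_nonneg_right ?_ (norm_nonneg _)
    rw [h3]
    exact mul_le_mul h4 h2 (norm_nonneg _) ENNReal.toReal_nonneg
  exact ⟨hmem.toLp _, hmem.coeFn_toLp⟩

/-- The linearised state exists, and its coefficients are those of the source times the solutions of
the mode equations. -/
lemma linearisedState_spec (hb : 0 < b) (hc : 0 < c) (hA : IsEllipticRealisation Ω A)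
    (hφ : ∀ j, (φ j, lam j • φ j) ∈ A.graph) (f : A.domain) (hβ₁ : Differentiable ℝ β)
    (hβ₂ : Differentiable ℝ (deriv β))
    (hβ₃ : ∀ τ : ℝ, MemLp (deriv (deriv β)) 2 (volume.restrict (Ioc 0 τ)))
    {z w : ℕ → ℝ → ℝ} (hz : ∀ j, IsModeSolution b c (lam j) (timeFactor β) (z j) (w j))
    {dκ : LInf Ω} {G : L2 Ω} (hG : ∀ᵐ x ∂(volume.restrict Ω), G x = dκ x * (f : L2 Ω) x ^ 2) :
    (∃ Z, IsLinearisedState A c b (excitation A c b f β) (β 0 • (f : L2 Ω))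
      (deriv β 0 • (f : L2 Ω)) dκ Z) ∧
    ∀ Z, IsLinearisedState A c b (excitation A c b f β) (β 0 • (f : L2 Ω))
      (deriv β 0 • (f : L2 Ω)) dκ Z → ∀ t, 0 ≤ t →
        (∃ v, (Z t, v) ∈ A.graph) ∧ ∀ j, inner ℝ (φ j) (Z t) = inner ℝ (φ j) G * z j t := by
  have hl := hA.eigenvalue_pos hφ
  obtain ⟨u, ut, utt, Au, Aut, hutt, hut, hu, hAu, hAut, hAutm, heq, hcoef⟩ :=
    exists_modal_solution hb hc hA.selfAdjoint hφ hl (memLp_timeFactor hβ₁ hβ₂ hβ₃) hz G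
  have hp := isStrongSolution_excitation (b := b) (c := c) f hβ₁ hβ₂ hβ₃
  -- the modal solution solves the equation with the source in separated form
  have heq' : ∀ᵐ t ∂(volume.restrict (Ioi (0 : ℝ))), ∀ᵐ x ∂(volume.restrict Ω),
      utt t x + c ^ 2 * Au t x + b * Aut t x = timeFactor β t * G x := by
    filter_upwards [heq] with t ht
    filter_upwards [Lp.coeFn_add (utt t + c ^ 2 • Au t) (b • Aut t),
      Lp.coeFn_add (utt t) (c ^ 2 • Au t), Lp.coeFn_smul (c ^ 2) (Au t), Lp.coeFn_smul b (Aut t),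
      Lp.coeFn_smul (timeFactor β t) G] with x e1 e2 e3 e4 e5
    rw [ht, e5, Pi.add_apply, e2, Pi.add_apply, e3, e4] at e1
    simpa using e1.symm
  have hsol : IsStrongSolution A c b (fun t x => timeFactor β t * G x) 0 0 u ut utt := by
    exact ⟨hutt, fun t ht => by rw [hut t ht, zero_add], fun t ht => by rw [hu t ht, zero_add],
      Au, Aut, hAu, hAut, hAutm, heq'⟩
  -- the source computed from a solution for `κ = 0`
  have hsource : ∀ {p pt ptt : ℝ → L2 Ω}, IsStrongSolution A c b (excitation A c b f β)
      (β 0 • (f : L2 Ω)) (deriv β 0 • (f : L2 Ω)) p pt ptt →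
      ∀ᵐ t ∂(volume.restrict (Ioi (0 : ℝ))),
        (fun x => 2 * dκ x * (p t x * ptt t x + pt t x ^ 2)) =ᵐ[volume.restrict Ω]
          fun x => timeFactor β t * G x := by
    intro p pt ptt hp'
    obtain ⟨h1, h2⟩ := hp'.eqOn hb hc hA.selfAdjoint hφ hl
      (Eventually.of_forall fun _ => EventuallyEq.rfl) hp
    filter_upwards [h2, ae_restrict_mem measurableSet_Ioi] with t e1 ht
    obtain ⟨e2, e3⟩ := h1 t (le_of_lt ht)
    rw [e1, e2, e3]
    filter_upwards [hG, Lp.coeFn_smul (β t) (f : L2 Ω), Lp.coeFn_smul (deriv β t) (f : L2 Ω),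
      Lp.coeFn_smul (deriv (deriv β) t) (f : L2 Ω)] with x f1 f2 f3 f4
    rw [f1, f2, f3, f4, timeFactor_eq hβ₁ hβ₂]
    simp only [Pi.smul_apply, smul_eq_mul]
    ring
  refine ⟨⟨u, _, _, _, ut, utt, hp, ⟨hsol.utt_memLp, hsol.ut_eq, hsol.u_eq, ?_⟩⟩, ?_⟩
  · refine ⟨Au, Aut, hAu, hAut, hAutm, ?_⟩
    filter_upwards [heq', hsource hp] with t h1 h2
    filter_upwards [h1, h2] with x h3 h4
    rw [h3, h4]
  · rintro Z ⟨p, pt, ptt, zt, ztt, hp', hZ⟩ t ht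
    have h1 := ((hZ.eqOn hb hc hA.selfAdjoint hφ hl (hsource hp') hsol).1 t ht).1
    rw [h1]
    exact ⟨⟨_, hAu t ht⟩, hcoef t ht⟩

/-- The eigenfunction expansion of the observation; in particular the choice made in
`linearisedForward` is immaterial. -/
lemma linearisedForward_eq (hd : d ≤ 3) (hΩ : IsOpen Ω) (hΩb : Bornology.IsBounded Ω)
    (hb : 0 < b) (hc : 0 < c) (hA : IsEllipticRealisation Ω A)
    (hφ : ∀ j, (φ j, lam j • φ j) ∈ A.graph) (f : A.domain) (hβ₁ : Differentiable ℝ β)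
    (hβ₂ : Differentiable ℝ (deriv β))
    (hβ₃ : ∀ τ : ℝ, MemLp (deriv (deriv β)) 2 (volume.restrict (Ioc 0 τ)))
    {z w : ℕ → ℝ → ℝ} (hz : ∀ j, IsModeSolution b c (lam j) (timeFactor β) (z j) (w j))
    {dκ : LInf Ω} {G : L2 Ω} (hG : ∀ᵐ x ∂(volume.restrict Ω), G x = dκ x * (f : L2 Ω) x ^ 2)
    {S : Set (E d)} (hS : S ⊆ closure Ω) {T : EReal} (x : S)
    (t : {t : ℝ // 0 < t ∧ (t : EReal) < T}) :
    HasSum (fun j => inner ℝ (φ j) G * z j t * pointValue Ω (φ j) x)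
      (linearisedForward A c b (excitation A c b f β) (β 0 • (f : L2 Ω))
        (deriv β 0 • (f : L2 Ω)) S T dκ x t) := by
  obtain ⟨hex, hspec⟩ := linearisedState_spec hb hc hA hφ f hβ₁ hβ₂ hβ₃ hz hG
  rw [linearisedForward, dif_pos hex]
  obtain ⟨⟨v, hv⟩, hcoef⟩ := hspec _ hex.choose_spec t t.2.1.le
  have := hasSum_pointValue hd hΩ hΩb hA hφ (hS x.2) hv
  simpa only [hcoef] using this

end Forward

/-! ### Injectivity -/

section Injectivity

lemma eq_zero_of_mulVec_eq_zero_of_rank {m n : Type*} [Fintype n] {M : Matrix m n ℝ}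
    (hM : M.rank = Fintype.card n) {v : n → ℝ} (hv : M.mulVec v = 0) : v = 0 := by
  have h1 := M.mulVecLin.finrank_range_add_finrank_ker
  rw [← Matrix.rank, hM, Module.finrank_pi, Nat.add_eq_left, Submodule.finrank_eq_zero] at h1
  have h2 : v ∈ LinearMap.ker M.mulVecLin := by
    rw [LinearMap.mem_ker, Matrix.mulVecLin_apply, hv]
  rwa [h1, Submodule.mem_bot] at h2

variable {d : ℕ} {Ω : Set (E d)} {A : L2 Ω →ₗ.[ℝ] L2 Ω} {b c : ℝ} {lam : ℕ → ℝ}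
  {φ : HilbertBasis ℕ ℝ (L2 Ω)}

/-- If the series of modes vanishes at the point `x` on a time interval on which the source acts,
then so does its part in every eigenspace. -/
lemma tsum_eigenspace_pointValue_eq_zero (hd : d ≤ 3) (hΩ : IsOpen Ω)
    (hΩb : Bornology.IsBounded Ω) (hb : 0 < b) (hc : 0 < c) (hA : IsEllipticRealisation Ω A)
    (hφ : ∀ j, (φ j, lam j • φ j) ∈ A.graph) {ψ : ℝ → ℝ} {τ : ℝ} (hτ : 0 < τ)
    (hψ : MemLp ψ 2 (volume.restrict (Ioc 0 τ)))
    (hψ0 : ¬ ∀ᵐ t ∂(volume.restrict (Ioc 0 τ)), ψ t = 0) {z w : ℕ → ℝ → ℝ}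
    (hz : ∀ j, IsModeSolution b c (lam j) ψ (z j) (w j)) (G : L2 Ω) {x : E d}
    (hx : x ∈ closure Ω) (h0 : ∀ t ∈ Ioo 0 τ,
      HasSum (fun j => inner ℝ (φ j) G * z j t * pointValue Ω (φ j) x) 0) (m : ℕ) :
    ∑' j, (if lam j = lam m then inner ℝ (φ j) G * pointValue Ω (φ j) x else 0) = 0 := by
  have hl := hA.eigenvalue_pos hφ
  set k : ℕ → ℝ := fun j => inner ℝ (φ j) G * (pointValue Ω (φ j) x / (1 + lam j)) with hk
  have hk1 : ∀ j, k j * (1 + lam j) = inner ℝ (φ j) G * pointValue Ω (φ j) x := by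
    intro j
    have := hl j
    simp only [hk]
    field_simp
  have hksum : Summable fun j => |k j| := by
    have h1 : Summable fun j => (inner ℝ (φ j) G : ℝ) ^ 2 := by
      simpa only [Real.norm_eq_abs, sq_abs] using φ.orthonormal.inner_products_summable (x := G)
    refine Summable.of_nonneg_of_le (fun j => abs_nonneg _) (fun j => ?_)
      (h1.add (summable_sq_pointValue hd hΩ hΩb hA hφ hx))
    simp only [hk]
    rw [abs_le]
    constructor <;>
    nlinarith [sq_nonneg (inner ℝ (φ j) G + pointValue Ω (φ j) x / (1 + lam j)),
      sq_nonneg (inner ℝ (φ j) G - pointValue Ω (φ j) x / (1 + lam j))]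
  obtain ⟨K, -, hK⟩ := exists_mode_bound hb hc hτ.le hψ
  have h2 : ∀ t ∈ Ioo 0 τ, ∑' j, k j * ((1 + lam j) * z j t) = 0 := by
    intro t ht
    rw [← (h0 t ht).tsum_eq]
    refine tsum_congr fun j => ?_
    rw [← mul_assoc, hk1]
    ring
  have h3 : ∀ j, ∀ t ∈ Icc 0 τ, |w j t| ≤ √K ∧ |(1 + lam j) * z j t| ≤ √K := fun j t ht =>
    ⟨Real.abs_le_sqrt ((hK _ (hl j) _ _ (hz j)).1 t ht).1,
      Real.abs_le_sqrt ((hK _ (hl j) _ _ (hz j)).1 t ht).2⟩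
  have h4 : 0 < 3 * max 1 (4 * c ^ 2 / b) + 1 := by
    have := le_max_left 1 (4 * c ^ 2 / b)
    linarith
  have h5 := tsum_eigenspace_eq_zero hb hc hl hksum h4
    (fun y hy => transfer_eq_zero hb hl hksum hτ hψ hψ0 hz h3 h2 hy) m
  simpa only [hk1] using h5

end Injectivity

end Westervelt

theorem mainTheorem3 (d : ℕ) (hd₁ : 1 ≤ d) (hd₃ : d ≤ 3)
    (Ω : Set (Westervelt.E d)) (hΩ : IsOpen Ω) (hΩb : Bornology.IsBounded Ω)
    (A : Westervelt.L2 Ω →ₗ.[ℝ] Westervelt.L2 Ω) (hA : Westervelt.IsEllipticRealisation Ω A)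
    (c b : ℝ) (hc : 0 < c) (hb : 0 < b)
    -- the eigensystem of `A`
    (lam : ℕ → ℝ) (φ : HilbertBasis ℕ ℝ (Westervelt.L2 Ω))
    (hφ : ∀ j, (φ j, lam j • φ j) ∈ A.graph)
    -- the observation set and the observation time
    (S : Set (Westervelt.E d)) (hS : S ⊆ closure Ω) (T : EReal)
    -- the excitation
    (f : A.domain) (hf : ∀ᵐ x ∂(volume.restrict Ω), (f : Westervelt.L2 Ω) x ≠ 0)
    (β : ℝ → ℝ) (hβ₁ : Differentiable ℝ β) (hβ₂ : Differentiable ℝ (deriv β))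
    (hβ₃ : ∀ τ : ℝ, MemLp (deriv (deriv β)) 2 (volume.restrict (Ioc 0 τ)))
    (t₀ : ℝ) (ht₀ : 0 < t₀) (ht₀T : (t₀ : EReal) < T) (hβt₀ : Westervelt.timeFactor β t₀ ≠ 0)
    -- nonvanishing of the Laplace transform at one of the poles, for each eigenvalue
    (hLaplace : ∀ m : ℕ,
      Westervelt.LaplaceNonvanishingAt (Westervelt.timeFactor β) (Westervelt.polePlus b c (lam m)) ∨
      Westervelt.LaplaceNonvanishingAt (Westervelt.timeFactor β) (Westervelt.poleMinus b c (lam m)))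
    -- the full rank condition on the observation set
    (hrank : ∀ m : ℕ, ∃ (_ : Fintype {k : ℕ // lam k = lam m}) (N : ℕ)
      (y : Fin N → Westervelt.E d), (∀ i, y i ∈ S) ∧
      (Matrix.of fun (i : Fin N) (k : {k : ℕ // lam k = lam m}) =>
        Westervelt.pointValue Ω (φ k) (y i)).rank = Fintype.card {k : ℕ // lam k = lam m}) :
    Function.Injective
      (Westervelt.linearisedForward A c b (Westervelt.excitation A c b f β)
        (β 0 • (f : Westervelt.L2 Ω)) (deriv β 0 • (f : Westervelt.L2 Ω)) S T) := by
  intro dκ₁ dκ₂ hF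
  have hl := hA.eigenvalue_pos hφ
  have hd := Westervelt.hasDerivAt_deriv_sq hβ₁ hβ₂
  simp only [← Westervelt.timeFactor_eq hβ₁ hβ₂] at hd
  choose z w hz using fun j => Westervelt.exists_isModeSolution b c (lam j) hd
  obtain ⟨G₁, hG₁⟩ := Westervelt.exists_source hd₃ hΩb hA f dκ₁
  obtain ⟨G₂, hG₂⟩ := Westervelt.exists_source hd₃ hΩb hA f dκ₂
  obtain ⟨τ, hτ₀, hτT⟩ := EReal.lt_iff_exists_real_btwn.1 ht₀T
  rw [EReal.coe_lt_coe_iff] at hτ₀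
  have hτ : 0 < τ := ht₀.trans hτ₀
  -- the observations determine the projection of the source to each eigenspace
  have hproj : ∀ m, ∀ x ∈ S, ∑' j, (if lam j = lam m then
      inner ℝ (φ j) (G₁ - G₂) * Westervelt.pointValue Ω (φ j) x else 0) = 0 := by
    intro m x hx
    refine Westervelt.tsum_eigenspace_pointValue_eq_zero hd₃ hΩ hΩb hb hc hA hφ hτ
      (Westervelt.memLp_timeFactor hβ₁ hβ₂ hβ₃ τ)
      (Westervelt.not_ae_timeFactor_eq_zero hβ₁ hβ₂ ht₀ hτ₀ hβt₀) hz _ (hS hx) (fun t ht => ?_) m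
    have htT : (t : EReal) < T := (EReal.coe_lt_coe_iff.2 ht.2).trans hτT
    have h1 := Westervelt.linearisedForward_eq hd₃ hΩ hΩb hb hc hA hφ f hβ₁ hβ₂ hβ₃ hz hG₁ hS
      ⟨x, hx⟩ (T := T) ⟨t, ht.1, htT⟩
    have h2 := Westervelt.linearisedForward_eq hd₃ hΩ hΩb hb hc hA hφ f hβ₁ hβ₂ hβ₃ hz hG₂ hS
      ⟨x, hx⟩ (T := T) ⟨t, ht.1, htT⟩
    have h3 := h1.sub h2
    rw [hF, sub_self] at h3
    refine h3.congr_fun fun j => ?_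
    rw [inner_sub_right]
    ring
  have hG : G₁ = G₂ := by
    refine Westervelt.ext_inner_basis φ fun m => ?_
    obtain ⟨_, N, y, hy, hr⟩ := hrank m
    have h1 := Westervelt.eq_zero_of_mulVec_eq_zero_of_rank hr
      (v := fun k => inner ℝ (φ k) (G₁ - G₂)) (by
        funext i
        rw [Pi.zero_apply, ← hproj m (y i) (hy i), Matrix.mulVec, dotProduct,
          ← tsum_fintype (L := .unconditional _)]
        simp only [Matrix.of_apply]
        refine (tsum_subtype {k | lam k = lam m} fun k => Westervelt.pointValue Ω (φ k) (y i) *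
          inner ℝ (φ k) (G₁ - G₂)).trans (tsum_congr fun j => ?_)
        simp only [indicator, mem_ofPred_eq]
        split_ifs
        · ring
        · rfl)
    have h2 := congrFun h1 ⟨m, rfl⟩
    simpa [inner_sub_right, sub_eq_zero] using h2
  refine Lp.ext ?_
  filter_upwards [hG₁, hG₂, hf] with x h1 h2 h3
  rw [hG, h2] at h1
  exact mul_right_cancel₀ (pow_ne_zero 2 h3) h1.symm
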